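/- A linear circuit over $\mathbb{C}$ is a sequence of instructions, each of which forms the sum or the difference of two, or a scalar multiple $\lambda u$ ($\lambda\in\mathbb{C}$) of one, of the inputs and previously computed results. A bilinear circuit with inputs $X_1,\dots,X_m,Y_1,\dots,Y_n$ is a sequence of instructions consisting of four consecutive parts: a linear circuit with inputs $X_i$; a linear circuit with inputs $Y_j$; multiplications, each of an element of the result sequence (inputs included) of the first part by one of the second part; and a linear circuit whose inputs are these products. It is a bounded coefficient (b.c.) circuit if every scalar $\lambda$ used satisfies $|\lambda|\le 2$; its size is its total number of instructions. It computes a bilinear map $\varphi\colon\mathbb{C}^m\times\mathbb{C}^n\to\mathbb{C}^p$ if all the component polynomials $\varphi_k(X,Y)$ are among its results. The b.c. complexity $\mathcal{C}(\varphi)$ is the size of a smallest b.c. bilinear circuit computing $\varphi$. For $n\ge 1$ let $\mathrm{mult}_n\colon\mathbb{C}^n\times\mathbb{C}^n\to\mathbb{C}^{2n-1}$ be the bilinear map that takes the coefficient vectors of two polynomials $f=\sum_{i=0}^{n-1}a_iX^i$ and $g=\sum_{i=0}^{n-1}b_iX^i$ in $\mathbb{C}[X]$ to the coefficient vector of the product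 $fg$. Corollary. The b.c. complexity of multiplying two polynomials of degree less than $n$ satisfies $$\mathcal{C}(\mathrm{mult}_n)\ \ge\ \tfrac{1}{12}\,n\log n-O(n\log\log n),$$ where $\log$ is the logarithm to base $2$. That is, there is a constant $C\in\mathbb{R}$ such that $\mathcal{C}(\mathrm{mult}_n)\ge\frac{1}{12}n\log n-C\,n\log\log n$ for all $n\ge 3$. -/

import Mathlib

/-- An instruction of a linear circuit, in a situation where `N` results (inputs included) are
available: the sum or difference of two of them, or a scalar multiple of one of them. -/
inductive LinInstr (N : ℕ) : Type where
  | add (i j : Fin N) : LinInstr N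
  | sub (i j : Fin N) : LinInstr N
  | smul (c : ℂ) (i : Fin N) : LinInstr N

namespace LinInstr

/-- The result of an instruction, given the results that are available so far. -/
def eval {V : Type*} [AddCommGroup V] [Module ℂ V] {N : ℕ} (v : Fin N → V) : LinInstr N → V
  | add i j => v i + v j
  | sub i j => v i - v j
  | smul c i => c • v i

/-- Bounded coefficients: scalars have absolute value at most `2`. -/
def IsBC {N : ℕ} : LinInstr N → Prop
  | add _ _ => True
  | sub _ _ => True
  | smul c _ => ‖c‖ ≤ 2

end LinInstr

/-- Linear circuits with `n` inputs and `r` instructions (straight-line programs over `ℂ` whose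
instructions are additions, subtractions and multiplications by scalars). Every instruction may
refer to the inputs and to the results of the preceding instructions. -/
inductive LinCircuit (n : ℕ) : ℕ → Type where
  | nil : LinCircuit n 0
  | snoc {r : ℕ} (Γ : LinCircuit n r) (I : LinInstr (n + r)) : LinCircuit n (r + 1)

namespace LinCircuit

/-- The result sequence on the input `x`: first the `n` inputs, then the `r` results of the
instructions. -/
def result {V : Type*} [AddCommGroup V] [Module ℂ V] {n : ℕ} (x : Fin n → V) :
    {r : ℕ} → LinCircuit n r → Fin (n + r) → V
  | _, nil => x
  | _, snoc Γ I => Fin.snoc (α := fun _ => V) (Γ.result x) (I.eval (Γ.result x))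

/-- Linear circuits with bounded coefficients. -/
def IsBC {n : ℕ} : {r : ℕ} → LinCircuit n r → Prop
  | _, nil => True
  | _, snoc Γ I => Γ.IsBC ∧ I.IsBC

end LinCircuit

/-- Bilinear circuits on inputs `X_0, …, X_{m-1}, Y_0, …, Y_{n-1}`. The sequence of instructions
consists of four consecutive parts:
* `lin₁`, a linear circuit with the `X_i` as inputs;
* `lin₂`, a linear circuit with the `Y_j` as inputs;
* `mul`, a sequence of multiplications, each of an element of the result sequence of `lin₁` by an
  element of the result sequence of `lin₂`;
* `lin₃`, a linear circuit with the results of `mul` as inputs. -/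
structure BilinCircuit (m n : ℕ) : Type where
  r₁ : ℕ
  r₂ : ℕ
  r₃ : ℕ
  r₄ : ℕ
  lin₁ : LinCircuit m r₁
  lin₂ : LinCircuit n r₂
  mul : Fin r₃ → Fin (m + r₁) × Fin (n + r₂)
  lin₃ : LinCircuit r₃ r₄

namespace BilinCircuit

variable {m n : ℕ}

/-- The number of instructions. -/
def size (Γ : BilinCircuit m n) : ℕ := Γ.r₁ + Γ.r₂ + Γ.r₃ + Γ.r₄

/-- Bilinear circuits with bounded coefficients. -/
def IsBC (Γ : BilinCircuit m n) : Prop := Γ.lin₁.IsBC ∧ Γ.lin₂.IsBC ∧ Γ.lin₃.IsBC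

/-- Results of the first part: polynomials (linear forms) in the `X_i`. -/
noncomputable def result₁ (Γ : BilinCircuit m n) :
    Fin (m + Γ.r₁) → MvPolynomial (Fin m ⊕ Fin n) ℂ :=
  Γ.lin₁.result fun i => MvPolynomial.X (Sum.inl i)

/-- Results of the second part: polynomials (linear forms) in the `Y_j`. -/
noncomputable def result₂ (Γ : BilinCircuit m n) :
    Fin (n + Γ.r₂) → MvPolynomial (Fin m ⊕ Fin n) ℂ :=
  Γ.lin₂.result fun j => MvPolynomial.X (Sum.inr j)

/-- Results of the multiplications. -/
noncomputable def result₃ (Γ : BilinCircuit m n) : Fin Γ.r₃ → MvPolynomial (Fin m ⊕ Fin n) ℂ :=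
  fun t => Γ.result₁ (Γ.mul t).1 * Γ.result₂ (Γ.mul t).2

/-- Results of the multiplications, followed by the results of the last part. -/
noncomputable def result₄ (Γ : BilinCircuit m n) :
    Fin (Γ.r₃ + Γ.r₄) → MvPolynomial (Fin m ⊕ Fin n) ℂ :=
  Γ.lin₃.result Γ.result₃

/-- The polynomials that occur in the result sequence of the whole circuit (inputs included). -/
def resultSet (Γ : BilinCircuit m n) : Set (MvPolynomial (Fin m ⊕ Fin n) ℂ) :=
  Set.range Γ.result₁ ∪ Set.range Γ.result₂ ∪ Set.range Γ.result₄

end BilinCircuit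

/-- The polynomial `∑ i j, φ_k(e_i, e_j) X_i Y_j` that describes the `k`-th component of the
bilinear map `φ`. -/
noncomputable def bilinPoly {m n p : ℕ}
    (φ : (Fin m → ℂ) →ₗ[ℂ] (Fin n → ℂ) →ₗ[ℂ] (Fin p → ℂ)) (k : Fin p) :
    MvPolynomial (Fin m ⊕ Fin n) ℂ :=
  ∑ i : Fin m, ∑ j : Fin n, φ (Pi.single i 1) (Pi.single j 1) k •
    (MvPolynomial.X (Sum.inl i) * MvPolynomial.X (Sum.inr j))

/-- The circuit `Γ` computes the bilinear map `φ`: all components of `φ` are among the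
results of `Γ`. -/
def BilinCircuit.Computes {m n p : ℕ} (Γ : BilinCircuit m n)
    (φ : (Fin m → ℂ) →ₗ[ℂ] (Fin n → ℂ) →ₗ[ℂ] (Fin p → ℂ)) : Prop :=
  ∀ k : Fin p, bilinPoly φ k ∈ Γ.resultSet

/-- The bounded coefficient complexity of a bilinear map: the size of a smallest bilinear circuit
with bounded coefficients that computes it. (There is one if `m` and `n` are positive,
see `exists_bilinCircuit`.) -/
noncomputable def bcComplexity {m n p : ℕ}
    (φ : (Fin m → ℂ) →ₗ[ℂ] (Fin n → ℂ) →ₗ[ℂ] (Fin p → ℂ)) : ℕ :=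
  sInf {s : ℕ | ∃ Γ : BilinCircuit m n, Γ.IsBC ∧ Γ.Computes φ ∧ Γ.size = s}

/-- The polynomial `∑ i < n, a_i X ^ i` with coefficient vector `a`, as a linear function of `a`. -/
noncomputable def polyOfCoeffs (n : ℕ) : (Fin n → ℂ) →ₗ[ℂ] Polynomial ℂ :=
  ∑ i : Fin n, Polynomial.monomial (i : ℕ) ∘ₗ LinearMap.proj i

/-- The vector of the coefficients of `1, X, …, X ^ (p - 1)`. -/
noncomputable def coeffsOfPoly (p : ℕ) : Polynomial ℂ →ₗ[ℂ] (Fin p → ℂ) :=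
  LinearMap.pi fun k => Polynomial.lcoeff ℂ (k : ℕ)

/-- Multiplication of two polynomials of degree less than `n`, as the bilinear map that takes their
coefficient vectors to the vector of the `2 n - 1` coefficients of the product. -/
noncomputable def polyMul (n : ℕ) :
    (Fin n → ℂ) →ₗ[ℂ] (Fin n → ℂ) →ₗ[ℂ] (Fin (2 * n - 1) → ℂ) :=
  ((LinearMap.mul ℂ (Polynomial ℂ)).compl₁₂ (polyOfCoeffs n) (polyOfCoeffs n)).compr₂
    (coeffsOfPoly (2 * n - 1))

/-! Every bilinear map on nonzero spaces is computed by some bilinear circuit with bounded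
coefficients, so that the infimum above is attained. -/

namespace LinCircuit

variable {V : Type*} [AddCommGroup V] [Module ℂ V] {n : ℕ} (x : Fin n → V)

theorem exists_snoc {r : ℕ} (Γ : LinCircuit n r) (hΓ : Γ.IsBC) (I : LinInstr (n + r))
    (hI : I.IsBC) : ∃ (r' : ℕ) (Γ' : LinCircuit n r'), Γ'.IsBC ∧
      Set.range (Γ.result x) ⊆ Set.range (Γ'.result x) ∧
      I.eval (Γ.result x) ∈ Set.range (Γ'.result x) := by
  refine ⟨r + 1, Γ.snoc I, ⟨hΓ, hI⟩, ?_, ?_⟩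
  · rintro _ ⟨i, rfl⟩
    exact ⟨Fin.castSucc i, by simp [result]⟩
  · exact ⟨Fin.last _, by simp [result]⟩

theorem exists_smul (k : ℕ) : ∀ {r : ℕ} (Γ : LinCircuit n r) (_ : Γ.IsBC) (c : ℂ)
    (_ : ‖c‖ ≤ 2 ^ (k + 1)) (v : V) (_ : v ∈ Set.range (Γ.result x)),
    ∃ (r' : ℕ) (Γ' : LinCircuit n r'), Γ'.IsBC ∧
      Set.range (Γ.result x) ⊆ Set.range (Γ'.result x) ∧ c • v ∈ Set.range (Γ'.result x) := by
  induction k with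
  | zero =>
    rintro r Γ hΓ c hc _ ⟨i, rfl⟩
    exact exists_snoc x Γ hΓ (.smul c i) (by simpa [LinInstr.IsBC] using hc)
  | succ k ih =>
    intro r Γ hΓ c hc v hv
    obtain ⟨r₁, Γ₁, h₁, hs₁, i, hi⟩ := ih Γ hΓ (c / 2) (by
      rw [norm_div, Complex.norm_ofNat, div_le_iff₀ (by norm_num)]; simpa [pow_succ] using hc) v hv
    obtain ⟨r₂, Γ₂, h₂, hs₂, hm⟩ := exists_snoc x Γ₁ h₁ (.smul 2 i) (by simp [LinInstr.IsBC])
    refine ⟨r₂, Γ₂, h₂, hs₁.trans hs₂, ?_⟩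
    simpa [LinInstr.eval, hi, smul_smul, mul_div_cancel₀] using hm

theorem exists_span (hn : 0 < n) (u : V) (hu : u ∈ Submodule.span ℂ (Set.range x)) :
    ∀ {r : ℕ} (Γ : LinCircuit n r) (_ : Γ.IsBC) (_ : Set.range x ⊆ Set.range (Γ.result x)),
    ∃ (r' : ℕ) (Γ' : LinCircuit n r'), Γ'.IsBC ∧
      Set.range (Γ.result x) ⊆ Set.range (Γ'.result x) ∧ u ∈ Set.range (Γ'.result x) := by
  induction hu using Submodule.span_induction with
  | mem v hv => exact fun Γ hΓ hx => ⟨_, Γ, hΓ, subset_rfl, hx hv⟩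
  | zero =>
    intro r Γ hΓ hx
    simpa using exists_smul x 0 Γ hΓ 0 (by simp) (x ⟨0, hn⟩) (hx ⟨_, rfl⟩)
  | add v w _ _ ihv ihw =>
    intro r Γ hΓ hx
    obtain ⟨r₁, Γ₁, h₁, hs₁, hv⟩ := ihv Γ hΓ hx
    obtain ⟨r₂, Γ₂, h₂, hs₂, j, hj⟩ := ihw Γ₁ h₁ (hx.trans hs₁)
    obtain ⟨i, hi⟩ := hs₂ hv
    obtain ⟨r₃, Γ₃, h₃, hs₃, hm⟩ := exists_snoc x Γ₂ h₂ (.add i j) trivial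
    refine ⟨r₃, Γ₃, h₃, (hs₁.trans hs₂).trans hs₃, ?_⟩
    simpa [LinInstr.eval, hi, hj] using hm
  | smul c v _ ihv =>
    intro r Γ hΓ hx
    obtain ⟨r₁, Γ₁, h₁, hs₁, hv⟩ := ihv Γ hΓ hx
    obtain ⟨k, hk⟩ := pow_unbounded_of_one_lt ‖c‖ (one_lt_two (α := ℝ))
    obtain ⟨r₂, Γ₂, h₂, hs₂, hm⟩ := exists_smul x k Γ₁ h₁ c
      (hk.le.trans (pow_le_pow_right₀ one_le_two k.le_succ)) v hv
    exact ⟨r₂, Γ₂, h₂, hs₁.trans hs₂, hm⟩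

theorem exists_family (hn : 0 < n) (p : ℕ) (u : Fin p → V)
    (hu : ∀ k, u k ∈ Submodule.span ℂ (Set.range x)) :
    ∃ (r : ℕ) (Γ : LinCircuit n r), Γ.IsBC ∧
      Set.range x ⊆ Set.range (Γ.result x) ∧ ∀ k, u k ∈ Set.range (Γ.result x) := by
  induction p with
  | zero => exact ⟨0, .nil, trivial, subset_rfl, fun k => k.elim0⟩
  | succ p ih =>
    obtain ⟨r, Γ, h, hs, hm⟩ := ih (fun k => u k.castSucc) (fun k => hu _)
    obtain ⟨r₁, Γ₁, h₁, hs₁, hm₁⟩ := exists_span x hn (u (Fin.last p)) (hu _) Γ h hs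
    refine ⟨r₁, Γ₁, h₁, hs.trans hs₁, fun k => ?_⟩
    induction k using Fin.lastCases with
    | last => exact hm₁
    | cast k => exact hs₁ (hm k)

end LinCircuit

theorem exists_bilinCircuit {m n p : ℕ} (hm : 0 < m) (hn : 0 < n)
    (φ : (Fin m → ℂ) →ₗ[ℂ] (Fin n → ℂ) →ₗ[ℂ] (Fin p → ℂ)) :
    ∃ Γ : BilinCircuit m n, Γ.IsBC ∧ Γ.Computes φ := by
  let x : Fin (m * n) → MvPolynomial (Fin m ⊕ Fin n) ℂ := fun t =>
    MvPolynomial.X (Sum.inl (finProdFinEquiv.symm t).1) *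
      MvPolynomial.X (Sum.inr (finProdFinEquiv.symm t).2)
  obtain ⟨r, Γ, h, -, hc⟩ := LinCircuit.exists_family x (Nat.mul_pos hm hn) p (bilinPoly φ) (by
    intro k
    refine Submodule.sum_mem _ fun i _ => Submodule.sum_mem _ fun j _ =>
      Submodule.smul_mem _ _ (Submodule.subset_span ⟨finProdFinEquiv (i, j), ?_⟩)
    simp only [x, Equiv.symm_apply_apply])
  exact ⟨⟨0, 0, m * n, r, .nil, .nil, finProdFinEquiv.symm, Γ⟩, ⟨trivial, trivial, h⟩,
    fun k => Or.inr (hc k)⟩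

/-! The proof bounds volumes. On the results of a b.c. linear circuit, each instruction at most
doubles the maximum of an alternating form (`LinCircuit.norm_alternatingMap_le`). A bilinear circuit
becomes linear in `Y` once a vector `a` is substituted for `X`. Its multiplications then become
scalings by results of the first part, so `a` must keep these small while the product map with `f`
fixed by `a` keeps a large volume.

Let `c k` be the coefficient vectors of the results of the first part. The Gram determinants of any
`r` of them are at most `2 ^ r₁ = D ^ r`. Hence Gram–Schmidt, always picking a vector farther than
`D` from the span so far, stops before reaching `r` vectors, and all `c k` have projections of norm
at most `D` on some space of dimension `n - r` (`exists_orthonormal_sum_inner_le`). A random sign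
combination of an orthonormal basis of this space keeps every result below `ρ * D`, with `ρ` of
order `√(log n)`, and gives at least `r` values of the discrete Fourier transform of squared modulus
at least `n / 6` (`exists_signs`, `LinCircuit.exists_input`).

After the substitution, an `r`-form bounded by `1` on the standard basis is at most `2 ^ (r₂ + r₄) *
(ρ * D) ^ r` on the components of the product. Evaluation at roots of unity turns these components
into multiples of orthogonal vectors by the Fourier values of `a`, so a suitable form is large
there. Comparing mean squares over all choices of arguments, with Parseval for the evaluation and a
factor `r!` from reorderings, gives `n ^ r ≤ (432 * ρ ^ 2) ^ r * 4 ^ size`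
(`BilinCircuit.pow_le_of_computes_polyMul`). Taking logarithms with `r` about `n / 6` produces the
constant `1 / 12`. -/

open scoped InnerProductSpace

/-! ### Linear circuits: naturality and result sets -/

namespace LinCircuit

variable {V W : Type*} [AddCommGroup V] [Module ℂ V] [AddCommGroup W] [Module ℂ W] {n : ℕ}

theorem map_result (T : V →ₗ[ℂ] W) (x : Fin n → V) {r : ℕ} (Γ : LinCircuit n r) (i : Fin (n + r)) :
    T (Γ.result x i) = Γ.result (fun j => T (x j)) i := by
  induction Γ with
  | nil => rfl
  | snoc Γ I ih =>
    induction i using Fin.lastCases with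
    | last => cases I <;> simp [result, LinInstr.eval, ih]
    | cast i => simpa [result] using ih i

theorem range_result_snoc (x : Fin n → V) {r : ℕ} (Γ : LinCircuit n r) (I : LinInstr (n + r)) :
    Set.range ((Γ.snoc I).result x) =
      insert (I.eval (Γ.result x)) (Set.range (Γ.result x)) := by
  ext v
  constructor
  · rintro ⟨i, rfl⟩
    induction i using Fin.lastCases with
    | last => left; simp [result]
    | cast i => right; exact ⟨i, by simp [result]⟩
  · rintro (rfl | ⟨i, rfl⟩)
    · exact ⟨Fin.last _, by simp [result]⟩
    · exact ⟨Fin.castSucc i, by simp [result]⟩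

end LinCircuit

/-! ### Alternating forms on circuit results and their mean squares -/

section Alternating

variable {V : Type*} [AddCommGroup V] [Module ℂ V] {q : ℕ}

/-- Two slots holding `y` make the form vanish, so the new vector needs to be considered in one slot
only. This is why an instruction costs a factor `2` and not `2 ^ q`. -/
theorem AlternatingMap.norm_le_of_mem_insert (Φ : V [⋀^Fin q]→ₗ[ℂ] ℂ) {A : Set V} {y : V} {M : ℝ}
    (hA : ∀ v : Fin q → V, (∀ j, v j ∈ A) → ‖Φ v‖ ≤ M)
    (hy : ∀ (v : Fin q → V) (j : Fin q), (∀ l ≠ j, v l ∈ A) → ‖Φ (Function.update v j y)‖ ≤ M)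
    (hM : 0 ≤ M) (v : Fin q → V) (hv : ∀ j, v j ∈ insert y A) : ‖Φ v‖ ≤ M := by
  by_cases h : ∃ j, v j = y
  · obtain ⟨j, hj⟩ := h
    by_cases h' : ∃ l ≠ j, v l = y
    · obtain ⟨l, hl, hly⟩ := h'
      rw [Φ.map_eq_zero_of_eq v (hly.trans hj.symm) hl]
      simpa using hM
    · push Not at h'
      have := hy v j fun l hl => (hv l).resolve_left (h' l hl)
      rwa [← hj, Function.update_eq_self] at this
  · push Not at h
    exact hA v fun j => (hv j).resolve_left (h j)

/-- Each instruction of a circuit with bounded coefficients at most doubles the largest value of an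
alternating form on the results. -/
theorem LinCircuit.norm_alternatingMap_le (Φ : V [⋀^Fin q]→ₗ[ℂ] ℂ) {n : ℕ} (x : Fin n → V) {M : ℝ}
    (hM : 0 ≤ M) (hx : ∀ κ : Fin q → Fin n, ‖Φ fun j => x (κ j)‖ ≤ M) {r : ℕ} (Γ : LinCircuit n r)
    (hΓ : Γ.IsBC) :
    ∀ v : Fin q → V, (∀ j, v j ∈ Set.range (Γ.result x)) → ‖Φ v‖ ≤ 2 ^ r * M := by
  induction Γ with
  | nil =>
    intro v hv
    choose κ hκ using hv
    have := hx κ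
    rwa [show (fun j => x (κ j)) = v from funext hκ, ← one_mul M, ← pow_zero (2 : ℝ)] at this
  | @snoc r Γ I ih =>
    have ih := ih hΓ.1
    have hMr : 0 ≤ 2 ^ r * M := by positivity
    have hup : ∀ (v : Fin q → V) (j : Fin q), (∀ l ≠ j, v l ∈ Set.range (Γ.result x)) →
        ∀ i, ‖Φ (Function.update v j (Γ.result x i))‖ ≤ 2 ^ r * M := by
      intro v j hv i
      refine ih _ fun l => ?_
      by_cases hl : l = j
      · subst hl; simp
      · simpa [hl] using hv l hl
    have hI := hΓ.2
    rw [range_result_snoc, pow_succ]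
    refine Φ.norm_le_of_mem_insert (fun v hv => (ih v hv).trans (by linarith)) ?_ (by linarith)
    intro v j hv
    cases I with
    | add i k =>
      rw [LinInstr.eval, Φ.map_update_add]
      linarith [norm_add_le (Φ (Function.update v j (Γ.result x i)))
        (Φ (Function.update v j (Γ.result x k))), hup v j hv i, hup v j hv k]
    | sub i k =>
      rw [LinInstr.eval, Φ.map_update_sub]
      linarith [norm_sub_le (Φ (Function.update v j (Γ.result x i)))
        (Φ (Function.update v j (Γ.result x k))), hup v j hv i, hup v j hv k]
    | smul c i =>
      rw [LinInstr.eval, Φ.map_update_smul, norm_smul]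
      have := mul_le_mul hI (hup v j hv i) (norm_nonneg _) zero_le_two
      linarith

theorem MultilinearMap.sum_norm_sq_succ {ι : Type*} [Fintype ι] {q : ℕ}
    (Φ : MultilinearMap ℂ (fun _ : Fin (q + 1) => V) ℂ) (g : ι → V) :
    ∑ σ : Fin (q + 1) → ι, ‖Φ fun j => g (σ j)‖ ^ 2 =
      ∑ a, ∑ s : Fin q → ι, ‖Φ.curryLeft (g a) fun j => g (s j)‖ ^ 2 := by
  rw [← Fintype.sum_prod_type', ← (Fin.consEquiv fun _ => ι).sum_comp]
  refine Finset.sum_congr rfl fun x _ => ?_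
  have : (fun j => g ((Fin.cons x.1 x.2 : Fin (q + 1) → ι) j)) =
      (Fin.cons (g x.1) fun j => g (x.2 j) : Fin (q + 1) → V) := by
    funext j
    cases j using Fin.cases <;> simp
  simp [Fin.consEquiv, this]

/-- The `q`-th tensor power of an operator with squared norm at most `B` has squared norm at most `B
^ q`; the induction applies `E` to one slot at a time. -/
theorem MultilinearMap.sum_norm_sq_le {ι κ : Type*} [Fintype ι] [Fintype κ] (E : ι → κ → ℂ) {B : ℝ}
    (hB : 0 ≤ B) (hE : ∀ x : κ → ℂ, ∑ i, ‖∑ k, E i k * x k‖ ^ 2 ≤ B * ∑ k, ‖x k‖ ^ 2)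
    (t : κ → V) (q : ℕ) (Φ : MultilinearMap ℂ (fun _ : Fin q => V) ℂ) :
    ∑ σ : Fin q → ι, ‖Φ fun j => ∑ k, E (σ j) k • t k‖ ^ 2 ≤
      B ^ q * ∑ τ : Fin q → κ, ‖Φ fun j => t (τ j)‖ ^ 2 := by
  induction q with
  | zero =>
    have h : ∀ v w : Fin 0 → V, Φ v = Φ w := fun v w => by rw [Subsingleton.elim v w]
    simp only [Fintype.sum_unique, pow_zero, one_mul]
    rw [h]
  | succ q ih =>
    rw [Φ.sum_norm_sq_succ fun i => ∑ k, E i k • t k, Φ.sum_norm_sq_succ t]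
    calc ∑ i, ∑ s : Fin q → ι, ‖Φ.curryLeft (∑ k, E i k • t k) fun j => ∑ k, E (s j) k • t k‖ ^ 2
        ≤ ∑ i, B ^ q * ∑ τ : Fin q → κ, ‖Φ.curryLeft (∑ k, E i k • t k) fun j => t (τ j)‖ ^ 2 :=
          Finset.sum_le_sum fun i _ => ih _
      _ = B ^ q * ∑ τ : Fin q → κ, ∑ i,
            ‖∑ k, E i k * Φ.curryLeft (t k) fun j => t (τ j)‖ ^ 2 := by
          rw [← Finset.mul_sum, Finset.sum_comm]
          simp
      _ ≤ B ^ q * ∑ τ : Fin q → κ, B * ∑ k, ‖Φ.curryLeft (t k) fun j => t (τ j)‖ ^ 2 := by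
          gcongr with τ
          exact hE _
      _ = _ := by
          rw [← Finset.mul_sum, Finset.sum_comm, pow_succ, mul_assoc]

/-- The `q!` reorderings of `κ` are distinct and change the form only by a sign. -/
theorem AlternatingMap.factorial_mul_norm_sq_le (Φ : V [⋀^Fin q]→ₗ[ℂ] ℂ) {ι : Type*} [Fintype ι]
    (v : ι → V) (κ : Fin q → ι) (hκ : Function.Injective κ) :
    (q.factorial : ℝ) * ‖Φ fun j => v (κ j)‖ ^ 2 ≤ ∑ σ : Fin q → ι, ‖Φ fun j => v (σ j)‖ ^ 2 := by
  classical
  have hinj : Function.Injective fun (p : Equiv.Perm (Fin q)) => κ ∘ p := by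
    intro p p' h
    ext j
    have := congrFun h j
    exact congrArg _ (hκ this)
  calc (q.factorial : ℝ) * ‖Φ fun j => v (κ j)‖ ^ 2
      = ∑ p : Equiv.Perm (Fin q), ‖Φ fun j => v (κ (p j))‖ ^ 2 := by
        have : ∀ p : Equiv.Perm (Fin q), ‖Φ fun j => v (κ (p j))‖ = ‖Φ fun j => v (κ j)‖ := by
          intro p
          have := Φ.map_perm (fun j => v (κ j)) p
          have h2 : ((fun j => v (κ j)) ∘ p) = fun j => v (κ (p j)) := rfl
          rw [h2] at this
          rw [this]
          rcases Int.units_eq_one_or (Equiv.Perm.sign p) with h | h <;> simp [h]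
        simp [this, Fintype.card_perm]
    _ = ∑ σ ∈ Finset.univ.image fun (p : Equiv.Perm (Fin q)) => κ ∘ p,
          ‖Φ fun j => v (σ j)‖ ^ 2 := by
        rw [Finset.sum_image fun p _ p' _ h => hinj h]
        rfl
    _ ≤ _ := Finset.sum_le_sum_of_subset_of_nonneg (Finset.subset_univ _) fun _ _ _ => by positivity

end Alternating

/-! ### Gram determinants against an orthonormal family -/

theorem sum_norm_sq_det_single_le (q : ℕ) :
    ∑ τ : Fin q → Fin q, ‖Matrix.detRowAlternating (R := ℂ) fun j =>
      (Pi.single (τ j) 1 : Fin q → ℂ)‖ ^ 2 ≤ q.factorial := by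
  classical
  have h0 : ∀ τ : Fin q → Fin q, ¬ Function.Injective τ →
      Matrix.detRowAlternating (R := ℂ) (fun j => (Pi.single (τ j) 1 : Fin q → ℂ)) = 0 := by
    intro τ hτ
    refine AlternatingMap.map_eq_zero_of_not_injective _ _ fun h => hτ ?_
    intro a b hab
    exact h (by simp [hab])
  have h1 : ∀ p : Equiv.Perm (Fin q),
      ‖Matrix.detRowAlternating (R := ℂ) (fun j => (Pi.single (p j) 1 : Fin q → ℂ))‖ = 1 := by
    intro p
    have := (Matrix.detRowAlternating (R := ℂ)).map_perm
      (fun j => (Pi.single j 1 : Fin q → ℂ)) p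
    have h2 : ((fun j => (Pi.single j 1 : Fin q → ℂ)) ∘ p) = fun j => Pi.single (p j) 1 := rfl
    have h3 : Matrix.detRowAlternating (R := ℂ) (fun j => (Pi.single j 1 : Fin q → ℂ)) = 1 := by
      have : (fun j => (Pi.single j 1 : Fin q → ℂ)) = (1 : Matrix (Fin q) (Fin q) ℂ) := by
        ext i j
        simp [Matrix.one_apply, Pi.single_apply, eq_comm]
      rw [this]
      exact Matrix.det_one
    rw [h2, h3] at this
    rw [this]
    rcases Int.units_eq_one_or (Equiv.Perm.sign p) with h | h <;> simp [h]
  have h2 : ∀ τ : Fin q → Fin q, Function.Injective τ → ∃ p : Equiv.Perm (Fin q), ⇑p = τ :=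
    fun τ hτ => ⟨Equiv.ofBijective τ (Finite.injective_iff_bijective.1 hτ), rfl⟩
  rw [← Finset.sum_subset (Finset.subset_univ
    (Finset.univ.image fun (p : Equiv.Perm (Fin q)) => (p : Fin q → Fin q)))]
  · rw [Finset.sum_image fun p _ p' _ h => DFunLike.coe_injective h]
    simp [h1, Fintype.card_perm]
  · intro τ _ hτ
    rw [h0 τ]
    · simp
    · intro hi
      obtain ⟨p, rfl⟩ := h2 τ hi
      simp at hτ

/-- The alternating form `v ↦ det ⟪u l, v j⟫`. -/
noncomputable def gramForm {n q : ℕ} (u : Fin q → EuclideanSpace ℂ (Fin n)) :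
    EuclideanSpace ℂ (Fin n) [⋀^Fin q]→ₗ[ℂ] ℂ :=
  Matrix.detRowAlternating.compLinearMap
    (LinearMap.pi fun l => (innerSL ℂ (u l)).toLinearMap)

theorem gramForm_apply {n q : ℕ} (u v : Fin q → EuclideanSpace ℂ (Fin n)) :
    gramForm u v = Matrix.det (Matrix.of fun j l => ⟪u l, v j⟫_ℂ) := rfl

/-- A minor of a matrix with orthonormal rows is at most `1`, by a Cauchy–Binet argument: the
squares of all such minors, over all index tuples, sum to at most `q!`, and each injective tuple is
counted `q!` times. -/
theorem norm_gramForm_single_le {n q : ℕ} {u : Fin q → EuclideanSpace ℂ (Fin n)}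
    (hu : Orthonormal ℂ u) (κ : Fin q → Fin n) :
    ‖gramForm u fun j => EuclideanSpace.single (κ j) 1‖ ≤ 1 := by
  classical
  by_cases hκ : Function.Injective κ
  swap
  · rw [AlternatingMap.map_eq_zero_of_not_injective]
    · simp
    · intro h
      refine hκ fun a b hab => h ?_
      simp [hab]
  let E : Fin n → Fin q → ℂ := fun k l => star (u l k)
  -- Up to conjugation, `E` sends `x` to `∑ l, star (x l) • u l`, so it is an isometry.
  have hE : ∀ x : Fin q → ℂ, ∑ k, ‖∑ l, E k l * x l‖ ^ 2 ≤ 1 * ∑ l, ‖x l‖ ^ 2 := by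
    intro x
    have h1 : ‖∑ l, star (x l) • u l‖ ^ 2 = ∑ l, ‖x l‖ ^ 2 := by
      have := hu.inner_sum (fun l => star (x l)) (fun l => star (x l)) Finset.univ
      rw [inner_self_eq_norm_sq_to_K] at this
      have h2 : ((‖∑ l, star (x l) • u l‖ ^ 2 : ℝ) : ℂ) = ((∑ l, ‖x l‖ ^ 2 : ℝ) : ℂ) := by
        push_cast
        rw [show ((‖∑ l, star (x l) • u l‖ : ℝ) : ℂ) ^ 2 = _ from this]
        refine Finset.sum_congr rfl fun l _ => ?_
        simp [Complex.mul_conj, Complex.normSq_eq_norm_sq]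
      exact_mod_cast h2
    rw [one_mul, ← h1, EuclideanSpace.norm_sq_eq]
    refine le_of_eq (Finset.sum_congr rfl fun k _ => ?_)
    rw [← norm_star (∑ l, E k l * x l)]
    simp [E, mul_comm]
  have hL : ∀ k : Fin n, (LinearMap.pi fun l => (innerSL ℂ (u l)).toLinearMap)
      (EuclideanSpace.single k (1 : ℂ)) = ∑ l, E k l • (Pi.single l 1 : Fin q → ℂ) := by
    intro k
    ext l
    simp [E, Finset.sum_apply, Pi.single_apply, EuclideanSpace.inner_single_right]
  have key := MultilinearMap.sum_norm_sq_le E zero_le_one hE (fun l => (Pi.single l 1 : Fin q → ℂ))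
    q (Matrix.detRowAlternating (R := ℂ)).toMultilinearMap
  have h3 := (gramForm u).factorial_mul_norm_sq_le (fun k => EuclideanSpace.single k (1 : ℂ)) κ hκ
  have h4 : ∑ σ : Fin q → Fin n, ‖gramForm u fun j => EuclideanSpace.single (σ j) (1 : ℂ)‖ ^ 2 ≤
      q.factorial := by
    refine le_trans (le_of_eq ?_) (key.trans ?_)
    · refine Finset.sum_congr rfl fun σ _ => ?_
      rw [gramForm, AlternatingMap.compLinearMap_apply]
      simp only [hL]
      rfl
    · rw [one_pow, one_mul]
      exact sum_norm_sq_det_single_le q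
  have hq : (0 : ℝ) < q.factorial := by positivity
  have h5 := le_of_mul_le_mul_left ((h3.trans h4).trans_eq (mul_one _).symm) hq
  exact (sq_le_one_iff₀ (norm_nonneg _)).1 h5

/-! ### Greedy Gram–Schmidt -/

section Greedy

variable {n : ℕ} {ι : Type*}

/-- An orthonormal family obtained from members of `c` by the Gram–Schmidt process, where all the
distances that occur exceed `D`. -/
structure IsGreedy (c : ι → EuclideanSpace ℂ (Fin n)) (D : ℝ) {q : ℕ}
    (v : Fin q → EuclideanSpace ℂ (Fin n)) (κ : Fin q → ι) : Prop where
  orthonormal : Orthonormal ℂ v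
  mem_span : ∀ m, c (κ m) ∈ Submodule.span ℂ (Set.range v)
  inner_eq_zero : ∀ l m, m < l → ⟪v l, c (κ m)⟫_ℂ = 0
  lt_inner : ∀ l, D < ‖⟪v l, c (κ l)⟫_ℂ‖

/-- The Gram matrix is triangular and its diagonal entries all exceed `D` in modulus. -/
theorem IsGreedy.pow_lt {c : ι → EuclideanSpace ℂ (Fin n)} {D : ℝ} (hD : 0 ≤ D) {q : ℕ}
    (hq : 0 < q) {v : Fin q → EuclideanSpace ℂ (Fin n)} {κ : Fin q → ι} (h : IsGreedy c D v κ) :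
    D ^ q < ‖gramForm v fun j => c (κ j)‖ := by
  have hdet := Matrix.det_of_isLowerTriangular
    (Matrix.of fun j l => ⟪v l, c (κ j)⟫_ℂ) fun j l hjl => h.inner_eq_zero l j hjl
  rw [gramForm_apply, hdet, norm_prod]
  have : D ^ q = ∏ _j : Fin q, D := by simp
  rw [this]
  rcases hD.eq_or_lt with rfl | hD
  · have : ∏ _j : Fin q, (0 : ℝ) = 0 := by simp [hq.ne']
    rw [this]
    exact Finset.prod_pos fun j _ => h.lt_inner j
  · exact Finset.prod_lt_prod_of_nonempty (fun _ _ => hD) (fun j _ => h.lt_inner j)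
      ⟨⟨0, hq⟩, Finset.mem_univ _⟩

/-- Any `n - r` members of an orthonormal basis of the complement of the span of `v` work: they only
see the residual of `c i`, and Bessel's inequality applies. -/
theorem exists_orthonormal_of_forall_norm_sub_le {c : ι → EuclideanSpace ℂ (Fin n)} {D : ℝ} {q : ℕ}
    {v : Fin q → EuclideanSpace ℂ (Fin n)} (hv : Orthonormal ℂ v)
    (h : ∀ i, ‖c i - ∑ l, ⟪v l, c i⟫_ℂ • v l‖ ≤ D) (r : ℕ) (hr : q ≤ r) :
    ∃ u : Fin (n - r) → EuclideanSpace ℂ (Fin n), Orthonormal ℂ u ∧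
      ∀ i, ∑ m, ‖⟪u m, c i⟫_ℂ‖ ^ 2 ≤ D ^ 2 := by
  set K := Submodule.span ℂ (Set.range v) with hK
  have h1 := finrank_span_eq_card hv.linearIndependent
  have h2 := K.finrank_add_finrank_orthogonal
  rw [← hK, Fintype.card_fin] at h1
  rw [finrank_euclideanSpace_fin] at h2
  let b := stdOrthonormalBasis ℂ Kᗮ
  have hle : n - r ≤ Module.finrank ℂ Kᗮ := by omega
  refine ⟨fun m => b (Fin.castLE hle m), ?_, fun i => ?_⟩
  · have := b.orthonormal.comp _ (Fin.castLE_injective hle)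
    exact this.comp_linearIsometry Kᗮ.subtypeₗᵢ
  · have hu : Orthonormal ℂ fun m => (b (Fin.castLE hle m) : EuclideanSpace ℂ (Fin n)) :=
      (b.orthonormal.comp _ (Fin.castLE_injective hle)).comp_linearIsometry Kᗮ.subtypeₗᵢ
    have hperp : ∀ m, ⟪(b (Fin.castLE hle m) : EuclideanSpace ℂ (Fin n)), c i⟫_ℂ =
        ⟪(b (Fin.castLE hle m) : EuclideanSpace ℂ (Fin n)),
          c i - ∑ l, ⟪v l, c i⟫_ℂ • v l⟫_ℂ := by
      intro m
      have hmem : ∑ l, ⟪v l, c i⟫_ℂ • v l ∈ K := Submodule.sum_mem _ fun l _ =>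
        Submodule.smul_mem _ _ (Submodule.subset_span ⟨l, rfl⟩)
      rw [inner_sub_right, Submodule.inner_left_of_mem_orthogonal hmem (b _).2, sub_zero]
    simp only [hperp]
    exact (hu.sum_inner_products_le _).trans (pow_le_pow_left₀ (norm_nonneg _) (h i) 2)

/-- The new vector is the normalised residual `w` of `c i`. It is orthogonal to the earlier selected
vectors, which lie in the old span, and its inner product with `c i` is `‖w‖`. -/
theorem IsGreedy.exists_succ {c : ι → EuclideanSpace ℂ (Fin n)} {D : ℝ} (hD : 0 ≤ D) {q : ℕ}
    {v : Fin q → EuclideanSpace ℂ (Fin n)} {κ : Fin q → ι} (h : IsGreedy c D v κ) {i : ι}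
    (hi : D < ‖c i - ∑ l, ⟪v l, c i⟫_ℂ • v l‖) :
    ∃ (v' : Fin (q + 1) → EuclideanSpace ℂ (Fin n)) (κ' : Fin (q + 1) → ι),
      IsGreedy c D v' κ' := by
  set w := c i - ∑ l, ⟪v l, c i⟫_ℂ • v l with hw
  have hvw : ∀ l, ⟪v l, w⟫_ℂ = 0 := by
    intro l
    rw [hw, inner_sub_right, h.orthonormal.inner_right_fintype, sub_self]
  have hwv : ∀ x ∈ Submodule.span ℂ (Set.range v), ⟪w, x⟫_ℂ = 0 := by
    intro x hx
    induction hx using Submodule.span_induction with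
    | mem x hx => obtain ⟨l, rfl⟩ := hx; exact inner_eq_zero_symm.1 (hvw l)
    | zero => simp
    | add x y _ _ hx hy => rw [inner_add_right, hx, hy, add_zero]
    | smul a x _ hx => rw [inner_smul_right, hx, mul_zero]
  have hci : c i = w + ∑ l, ⟪v l, c i⟫_ℂ • v l := by rw [hw]; abel
  have hsum : ∑ l, ⟪v l, c i⟫_ℂ • v l ∈ Submodule.span ℂ (Set.range v) :=
    Submodule.sum_mem _ fun l _ => Submodule.smul_mem _ _ (Submodule.subset_span ⟨l, rfl⟩)
  have hpos : 0 < ‖w‖ := hD.trans_lt hi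
  have hne : (‖w‖ : ℂ) ≠ 0 := by exact_mod_cast hpos.ne'
  have hwc : ⟪w, c i⟫_ℂ = (‖w‖ : ℂ) ^ 2 := by
    rw [hci, inner_add_right, hwv _ hsum, add_zero]
    exact inner_self_eq_norm_sq_to_K w
  have hrange : Set.range v ⊆
      Set.range (Fin.snoc v ((‖w‖ : ℂ)⁻¹ • w) : Fin (q + 1) → EuclideanSpace ℂ (Fin n)) := by
    rintro _ ⟨l, rfl⟩
    exact ⟨l.castSucc, by simp⟩
  refine ⟨Fin.snoc v ((‖w‖ : ℂ)⁻¹ • w), Fin.snoc κ i, ⟨⟨?_, ?_⟩, ?_, ?_, ?_⟩⟩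
  · intro l
    induction l using Fin.lastCases with
    | last => simp [norm_smul, hpos.ne']
    | cast l => simpa using h.orthonormal.1 l
  · intro l m hlm
    induction l using Fin.lastCases with
    | last =>
      induction m using Fin.lastCases with
      | last => exact absurd rfl hlm
      | cast m => simp [inner_smul_left, inner_eq_zero_symm.1 (hvw m)]
    | cast l =>
      induction m using Fin.lastCases with
      | last => simp [inner_smul_right, hvw l]
      | cast m => simpa using h.orthonormal.2 (fun e => hlm (by rw [e]))
  · intro m
    induction m using Fin.lastCases with
    | last =>
      rw [Fin.snoc_last, hci]
      refine Submodule.add_mem _ ?_ (Submodule.span_mono hrange hsum)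
      have : w = (‖w‖ : ℂ) • ((‖w‖ : ℂ)⁻¹ • w) := by rw [smul_smul, mul_inv_cancel₀ hne, one_smul]
      rw [this]
      exact Submodule.smul_mem _ _ (Submodule.subset_span ⟨Fin.last _, by simp [← this]⟩)
    | cast m => simpa using Submodule.span_mono hrange (h.mem_span m)
  · intro l m hlm
    induction m using Fin.lastCases with
    | last => exact absurd hlm (Fin.le_last l).not_gt
    | cast m =>
      induction l using Fin.lastCases with
      | last => simp [hwv _ (h.mem_span m)]
      | cast l => simpa using h.inner_eq_zero l m (by simpa using hlm)
  · intro l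
    induction l using Fin.lastCases with
    | last =>
      have : ‖w‖ ^ 2 * ‖w‖⁻¹ = ‖w‖ := by field_simp
      simpa [inner_smul_left, hwc, this] using hi
    | cast l => simpa using h.lt_inner l

/-- If all Gram determinants of `r` members of `c` are small, then the members of `c` are close to a
common subspace of dimension at most `r`. -/
theorem exists_orthonormal_sum_inner_le {c : ι → EuclideanSpace ℂ (Fin n)} {D : ℝ} (hD : 0 ≤ D)
    {r : ℕ} (hr : 0 < r)
    (h : ∀ v : Fin r → EuclideanSpace ℂ (Fin n), Orthonormal ℂ v → ∀ κ : Fin r → ι,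
      ‖gramForm v fun j => c (κ j)‖ ≤ D ^ r) :
    ∃ u : Fin (n - r) → EuclideanSpace ℂ (Fin n), Orthonormal ℂ u ∧
      ∀ i, ∑ m, ‖⟪u m, c i⟫_ℂ‖ ^ 2 ≤ D ^ 2 := by
  by_contra hcon
  have key : ∀ q ≤ r, ∃ (v : Fin q → EuclideanSpace ℂ (Fin n)) (κ : Fin q → ι),
      IsGreedy c D v κ := by
    intro q
    induction q with
    | zero =>
      intro _
      exact ⟨Fin.elim0, Fin.elim0, ⟨⟨fun i => i.elim0, fun i => i.elim0⟩, fun i => i.elim0,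
        fun i => i.elim0, fun i => i.elim0⟩⟩
    | succ q ih =>
      intro hq
      obtain ⟨v, κ, hv⟩ := ih (by omega)
      by_cases hs : ∀ i, ‖c i - ∑ l, ⟪v l, c i⟫_ℂ • v l‖ ≤ D
      · exact absurd (exists_orthonormal_of_forall_norm_sub_le hv.orthonormal hs r (by omega)) hcon
      · push Not at hs
        obtain ⟨i, hi⟩ := hs
        exact hv.exists_succ hD hi
  obtain ⟨v, κ, hv⟩ := key r le_rfl
  exact absurd (h v hv.orthonormal κ) (hv.pow_lt hD hr).not_ge

end Greedy

/-! ### Random signs -/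

/-- The mean of a function of `p` independent uniformly distributed signs. -/
noncomputable def signMean : (p : ℕ) → ((Fin p → ℝ) → ℝ) → ℝ
  | 0, g => g Fin.elim0
  | p + 1, g => signMean p fun x => (g (Fin.cons 1 x) + g (Fin.cons (-1) x)) / 2

namespace signMean

theorem add (p : ℕ) (f g : (Fin p → ℝ) → ℝ) :
    signMean p (fun x => f x + g x) = signMean p f + signMean p g := by
  induction p with
  | zero => rfl
  | succ p ih =>
    rw [signMean, signMean, signMean, ← ih]
    congr 1; funext x; ring

theorem const_mul (p : ℕ) (a : ℝ) (f : (Fin p → ℝ) → ℝ) :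
    signMean p (fun x => a * f x) = a * signMean p f := by
  induction p with
  | zero => rfl
  | succ p ih =>
    rw [signMean, signMean, ← ih]
    congr 1; funext x; ring

theorem const (p : ℕ) (a : ℝ) : signMean p (fun _ => a) = a := by
  induction p with
  | zero => rfl
  | succ p ih => rw [signMean]; simpa using ih

theorem sum (p : ℕ) {ι : Type*} (s : Finset ι) (f : ι → (Fin p → ℝ) → ℝ) :
    signMean p (fun x => ∑ i ∈ s, f i x) = ∑ i ∈ s, signMean p (f i) := by
  classical
  induction s using Finset.induction_on with
  | empty => simpa using const p 0
  | insert i s hi ih => simp only [Finset.sum_insert hi, add, ih]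

theorem mono (p : ℕ) {f g : (Fin p → ℝ) → ℝ} (h : ∀ x, f x ≤ g x) :
    signMean p f ≤ signMean p g := by
  induction p with
  | zero => exact h _
  | succ p ih => exact ih fun x => by linarith [h (Fin.cons 1 x), h (Fin.cons (-1) x)]

theorem exists_le (p : ℕ) (f : (Fin p → ℝ) → ℝ) : ∃ x, signMean p f ≤ f x := by
  induction p with
  | zero => exact ⟨_, le_rfl⟩
  | succ p ih =>
    obtain ⟨x, hx⟩ := ih fun x => (f (Fin.cons 1 x) + f (Fin.cons (-1) x)) / 2
    rcases le_total (f (Fin.cons 1 x)) (f (Fin.cons (-1) x)) with h | h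
    · exact ⟨Fin.cons (-1) x, hx.trans (by linarith)⟩
    · exact ⟨Fin.cons 1 x, hx.trans (by linarith)⟩

theorem norm_sq (p : ℕ) (c : Fin p → ℂ) :
    signMean p (fun x => ‖∑ m, x m * c m‖ ^ 2) = ∑ m, ‖c m‖ ^ 2 := by
  induction p with
  | zero => simp [signMean]
  | succ p ih =>
    rw [signMean, Fin.sum_univ_succ, ← ih fun m => c m.succ, ← const p (‖c 0‖ ^ 2), ← add]
    congr 1; funext x
    simp only [Fin.sum_univ_succ, Fin.cons_zero, Fin.cons_succ]
    have := parallelogram_law_with_norm ℂ (∑ m, x m * c m.succ) (c 0)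
    push_cast
    rw [one_mul, neg_one_mul, add_comm (c 0), neg_add_eq_sub]
    linarith

/-- The average equals `(‖z‖² + ‖c‖²)² + 4 (Re (z c̄))²`; the last square is at most `‖z‖² ‖c‖²`. -/
theorem norm_pow_four_avg_le (z c : ℂ) :
    (‖c + z‖ ^ 4 + ‖-c + z‖ ^ 4) / 2 ≤ ‖z‖ ^ 4 + 6 * ‖c‖ ^ 2 * ‖z‖ ^ 2 + ‖c‖ ^ 4 := by
  have h : ∀ w : ℂ, ‖w‖ ^ 2 = w.re ^ 2 + w.im ^ 2 := fun w => by
    rw [← Complex.normSq_eq_norm_sq, Complex.normSq_apply]; ring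
  have h4 : ∀ w : ℂ, ‖w‖ ^ 4 = (w.re ^ 2 + w.im ^ 2) ^ 2 := fun w => by rw [← h]; ring
  rw [h4, h4, h4, h4, h, h]
  simp only [Complex.add_re, Complex.add_im, Complex.neg_re, Complex.neg_im]
  nlinarith [sq_nonneg (c.re * z.im - c.im * z.re)]

/-- Khintchine's inequality for the fourth moment. With `norm_sq` it shows that a random sum is
unlikely to be much smaller than its root mean square. -/
theorem norm_pow_four_le (p : ℕ) (c : Fin p → ℂ) :
    signMean p (fun x => ‖∑ m, x m * c m‖ ^ 4) ≤ 3 * (∑ m, ‖c m‖ ^ 2) ^ 2 := by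
  induction p with
  | zero => simp [signMean]
  | succ p ih =>
    have h1 := ih fun m => c m.succ
    have h2 := norm_sq p fun m => c m.succ
    have h3 : signMean (p + 1) (fun x => ‖∑ m, x m * c m‖ ^ 4) ≤
        signMean p fun x => ‖∑ m, x m * c m.succ‖ ^ 4 +
          (6 * ‖c 0‖ ^ 2 * ‖∑ m, x m * c m.succ‖ ^ 2 + ‖c 0‖ ^ 4) := by
      rw [signMean]
      refine mono p fun x => ?_
      simp only [Fin.sum_univ_succ, Fin.cons_zero, Fin.cons_succ]
      push_cast
      rw [one_mul, neg_one_mul]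
      linarith [norm_pow_four_avg_le (∑ m, x m * c m.succ) (c 0)]
    rw [add, add, const_mul, const, h2] at h3
    rw [Fin.sum_univ_succ]
    nlinarith [pow_nonneg (norm_nonneg (c 0)) 4]

theorem exp_le (p : ℕ) (c : Fin p → ℝ) :
    signMean p (fun x => Real.exp (∑ m, x m * c m)) ≤ Real.exp ((∑ m, c m ^ 2) / 2) := by
  induction p with
  | zero => simp [signMean]
  | succ p ih =>
    have h1 : signMean (p + 1) (fun x => Real.exp (∑ m, x m * c m)) =
        Real.cosh (c 0) * signMean p fun x => Real.exp (∑ m, x m * c m.succ) := by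
      rw [signMean, ← const_mul]
      congr 1; funext x
      simp only [Fin.sum_univ_succ, Fin.cons_zero, Fin.cons_succ, Real.cosh_eq, one_mul,
        neg_one_mul, Real.exp_add]
      ring
    rw [h1, Fin.sum_univ_succ, add_div, Real.exp_add]
    exact mul_le_mul (Real.cosh_le_exp_half_sq _) (ih _)
      ((const p 0).symm.le.trans (mono p fun x => (Real.exp_pos _).le)) (Real.exp_pos _).le

end signMean

open signMean in
/-- Signs for which many of the sums `∑ x m * b i m` are not small while none of the sums
`∑ x m * c k m` is large. -/
theorem exists_signs {p n K : ℕ} (b : Fin n → Fin p → ℂ) (c : Fin K → Fin p → ℂ) {D ρ : ℝ}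
    (hD : 0 < D) (hρ : 0 ≤ ρ) (hb : ∀ i, ∑ m, ‖b i m‖ ^ 2 ≤ 1)
    (hc : ∀ k, ∑ m, ‖c k m‖ ^ 2 ≤ D ^ 2) (hK : 400 * K ≤ Real.exp (ρ ^ 2 / 8)) {s : ℝ}
    (hs : s < -(27 / 200) * n + 3 / 8 * ∑ i, ∑ m, ‖b i m‖ ^ 2) (hs0 : 0 ≤ s) :
    ∃ x : Fin p → ℝ, (∀ k, ‖∑ m, x m * c k m‖ ≤ ρ * D) ∧
      s < ((Finset.univ.filter fun i => 1 / 6 ≤ ‖∑ m, x m * b i m‖ ^ 2).card : ℝ) := by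
  -- With this `t` the exponential moments are at most `exp (ρ² / 8)`, while a sum exceeding `ρ * D`
  -- has real or imaginary part at least `ρ * D / 2` in modulus and forces `Y` up to `exp (ρ² / 4)`.
  set t := ρ / (2 * D) with ht
  have ht0 : 0 ≤ t := by positivity
  let Y : Fin K → (Fin p → ℝ) → ℝ := fun k x =>
    (Real.exp (∑ m, x m * (t * (c k m).re)) + Real.exp (∑ m, x m * (-t * (c k m).re))) +
    (Real.exp (∑ m, x m * (t * (c k m).im)) + Real.exp (∑ m, x m * (-t * (c k m).im)))
  have hexp : ∀ (k : Fin K) (d : Fin p → ℝ) (a : ℝ), a ^ 2 = t ^ 2 →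
      (∀ m, d m ^ 2 ≤ ‖c k m‖ ^ 2) →
      signMean p (fun x => Real.exp (∑ m, x m * (a * d m))) ≤ Real.exp (ρ ^ 2 / 8) := by
    intro k d a ha hd
    refine (exp_le p _).trans (Real.exp_le_exp.2 ?_)
    have h1 : ∑ m, (a * d m) ^ 2 ≤ t ^ 2 * D ^ 2 := by
      refine le_trans ?_ (mul_le_mul_of_nonneg_left (hc k) (sq_nonneg t))
      rw [Finset.mul_sum]
      refine Finset.sum_le_sum fun m _ => ?_
      rw [mul_pow, ha]
      exact mul_le_mul_of_nonneg_left (hd m) (sq_nonneg t)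
    have h2 : t ^ 2 * D ^ 2 = ρ ^ 2 / 4 := by rw [ht]; field_simp; norm_num
    linarith
  have hsq : ∀ w : ℂ, ‖w‖ ^ 2 = w.re ^ 2 + w.im ^ 2 := fun w => by
    rw [← Complex.normSq_eq_norm_sq, Complex.normSq_apply]; ring
  have hY : ∀ k, signMean p (Y k) ≤ 4 * Real.exp (ρ ^ 2 / 8) := by
    intro k
    have hre : ∀ m, (c k m).re ^ 2 ≤ ‖c k m‖ ^ 2 := fun m => by
      rw [hsq]; linarith [sq_nonneg (c k m).im]
    have him : ∀ m, (c k m).im ^ 2 ≤ ‖c k m‖ ^ 2 := fun m => by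
      rw [hsq]; linarith [sq_nonneg (c k m).re]
    simp only [Y]
    rw [add, add, add]
    linarith [hexp k _ t rfl hre, hexp k _ (-t) (neg_sq t) hre, hexp k _ t rfl him,
      hexp k _ (-t) (neg_sq t) him]
  have hYbad : ∀ k x, ρ * D < ‖∑ m, x m * c k m‖ → Real.exp (ρ ^ 2 / 4) ≤ Y k x := by
    intro k x hx
    have e1 : ∀ a : ℝ, ∑ m, x m * (a * (c k m).re) = a * (∑ m, x m * c k m).re := by
      intro a
      rw [Complex.re_sum, Finset.mul_sum]
      exact Finset.sum_congr rfl fun m _ => by rw [Complex.re_ofReal_mul]; ring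
    have e2 : ∀ a : ℝ, ∑ m, x m * (a * (c k m).im) = a * (∑ m, x m * c k m).im := by
      intro a
      rw [Complex.im_sum, Finset.mul_sum]
      exact Finset.sum_congr rfl fun m _ => by rw [Complex.im_ofReal_mul]; ring
    have h1 := Complex.norm_le_abs_re_add_abs_im (∑ m, x m * c k m)
    have h2 : t * (ρ * D) = ρ ^ 2 / 2 := by rw [ht]; field_simp
    have habs : ∀ a : ℝ, ρ * D / 2 ≤ |a| →
        Real.exp (ρ ^ 2 / 4) ≤ Real.exp (t * a) + Real.exp (-t * a) := by
      intro a ha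
      have h3 := mul_le_mul_of_nonneg_left ha ht0
      rcases abs_cases a with ⟨h, -⟩ | ⟨h, -⟩ <;> rw [h] at h3
      · exact (Real.exp_le_exp.2 (by linarith)).trans (le_add_of_nonneg_right (Real.exp_pos _).le)
      · exact (Real.exp_le_exp.2 (by linarith)).trans (le_add_of_nonneg_left (Real.exp_pos _).le)
    simp only [Y, e1, e2]
    rcases le_total (ρ * D / 2) |(∑ m, x m * c k m).re| with h | h
    · exact (habs _ h).trans (le_add_of_nonneg_right (by positivity))
    · exact (habs _ (by linarith)).trans (le_add_of_nonneg_left (by positivity))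
  -- In terms of `y = ‖∑ x m * b i m‖²` this is `-1/8 + 3y/4 - y²/8`, a quadratic minorant of the
  -- indicator of `1/6 ≤ y`: its maximum is `1`, at `y = 3`, and it is negative for `0 ≤ y < 1/6`.
  let h : Fin n → (Fin p → ℝ) → ℝ := fun i x =>
    (-(1 / 8) + 3 / 4 * ‖∑ m, x m * b i m‖ ^ 2) + -(1 / 8) * ‖∑ m, x m * b i m‖ ^ 4
  -- The penalty has mean at most `n / 100`, which turns `-1/8` into `-27/200`. It is at least `n`
  -- as soon as one sum is too large, and then `F` cannot be positive.
  let F : (Fin p → ℝ) → ℝ := fun x =>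
    ∑ i, h i x + -(n * Real.exp (-(ρ ^ 2 / 4))) * ∑ k, Y k x
  have hh : ∀ i, -(1 / 8) + 3 / 8 * ∑ m, ‖b i m‖ ^ 2 ≤ signMean p (h i) := by
    intro i
    simp only [h]
    rw [add, add, const, const_mul, const_mul, norm_sq]
    have h1 := norm_pow_four_le p (b i)
    have h2 : (0 : ℝ) ≤ ∑ m, ‖b i m‖ ^ 2 := Finset.sum_nonneg fun _ _ => by positivity
    nlinarith [hb i]
  have hF : -(27 / 200) * n + 3 / 8 * ∑ i, ∑ m, ‖b i m‖ ^ 2 ≤ signMean p F := by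
    simp only [F]
    rw [add, const_mul, sum, sum]
    have h1 : -(1 / 8) * n + 3 / 8 * ∑ i, ∑ m, ‖b i m‖ ^ 2 ≤ ∑ i, signMean p (h i) := by
      refine le_trans (le_of_eq ?_) (Finset.sum_le_sum fun i _ => hh i)
      rw [Finset.sum_add_distrib, Finset.mul_sum]
      simp [mul_comm]
    have h2 : ∑ k, signMean p (Y k) ≤ K * (4 * Real.exp (ρ ^ 2 / 8)) := by
      refine (Finset.sum_le_sum fun k _ => hY k).trans_eq ?_
      simp
    have h3 : Real.exp (-(ρ ^ 2 / 4)) * (K * (4 * Real.exp (ρ ^ 2 / 8))) ≤ 1 / 100 := by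
      have e : Real.exp (-(ρ ^ 2 / 4)) * Real.exp (ρ ^ 2 / 8) * Real.exp (ρ ^ 2 / 8) = 1 := by
        rw [← Real.exp_add, ← Real.exp_add, ← Real.exp_zero]; congr 1; ring
      have := mul_le_mul_of_nonneg_left hK
        (mul_pos (Real.exp_pos (-(ρ ^ 2 / 4))) (Real.exp_pos (ρ ^ 2 / 8))).le
      rw [e] at this
      linarith
    have h4 : n * Real.exp (-(ρ ^ 2 / 4)) * ∑ k, signMean p (Y k) ≤ n * (1 / 100) := by
      rw [mul_assoc]
      exact mul_le_mul_of_nonneg_left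
        ((mul_le_mul_of_nonneg_left h2 (Real.exp_pos _).le).trans h3) (Nat.cast_nonneg n)
    linarith
  obtain ⟨x, hx⟩ := exists_le p F
  have hFx := hs.trans_le (hF.trans hx)
  have hh1 : ∀ i, h i x ≤ if 1 / 6 ≤ ‖∑ m, x m * b i m‖ ^ 2 then 1 else 0 := by
    intro i
    have e : ‖∑ m, x m * b i m‖ ^ 4 = (‖∑ m, x m * b i m‖ ^ 2) ^ 2 := by ring
    simp only [h, e]
    split_ifs with hi
    · nlinarith [sq_nonneg (‖∑ m, x m * b i m‖ ^ 2 - 3)]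
    · push Not at hi
      nlinarith [sq_nonneg (‖∑ m, x m * b i m‖)]
  have hcard : ∑ i, h i x ≤
      ((Finset.univ.filter fun i => 1 / 6 ≤ ‖∑ m, x m * b i m‖ ^ 2).card : ℝ) := by
    refine (Finset.sum_le_sum fun i _ => hh1 i).trans_eq ?_
    simp
  have hY0 : ∀ k, 0 ≤ Y k x := fun k => by positivity
  have hsumY : 0 ≤ ∑ k, Y k x := Finset.sum_nonneg fun k _ => hY0 k
  refine ⟨x, fun k => ?_, ?_⟩
  · by_contra hk
    push Not at hk
    have h1 := (hYbad k x hk).trans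
      (Finset.single_le_sum (fun k _ => hY0 k) (Finset.mem_univ k))
    have h2 : (n : ℝ) ≤ n * Real.exp (-(ρ ^ 2 / 4)) * ∑ k, Y k x := by
      rw [mul_assoc]
      refine le_mul_of_one_le_right (Nat.cast_nonneg n) ?_
      have := mul_le_mul_of_nonneg_left h1 (Real.exp_pos (-(ρ ^ 2 / 4))).le
      rwa [← Real.exp_add, neg_add_cancel, Real.exp_zero] at this
    have h3 : ((Finset.univ.filter fun i => 1 / 6 ≤ ‖∑ m, x m * b i m‖ ^ 2).card : ℝ) ≤ n := by
      exact_mod_cast (Finset.card_le_univ _).trans_eq (Fintype.card_fin n)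
    simp only [F] at hFx
    linarith
  · have h2 : 0 ≤ n * Real.exp (-(ρ ^ 2 / 4)) * ∑ k, Y k x := by positivity
    simp only [F] at hFx
    linarith

/-! ### Roots of unity and Parseval's identity -/

section Fourier

theorem IsPrimitiveRoot.sum_star_pow_mul_pow {N : ℕ} {ζ : ℂ} (hζ : IsPrimitiveRoot ζ N) (hN : 0 < N)
    {k l : ℕ} (hk : k < N) (hl : l < N) :
    ∑ i : Fin N, star (ζ ^ ((i : ℕ) * k)) * ζ ^ ((i : ℕ) * l) = if k = l then (N : ℂ) else 0 := by
  have hnorm : ‖ζ‖ = 1 := hζ.norm'_eq_one hN.ne'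
  have hstar : star ζ * ζ = 1 := by
    rw [mul_comm, Complex.star_def, Complex.mul_conj, Complex.normSq_eq_norm_sq, hnorm]; simp
  set z := star (ζ ^ k) * ζ ^ l with hz
  have h1 : ∀ i : Fin N, star (ζ ^ ((i : ℕ) * k)) * ζ ^ ((i : ℕ) * l) = z ^ (i : ℕ) := by
    intro i
    rw [hz, mul_pow, ← star_pow, ← pow_mul, ← pow_mul, mul_comm k, mul_comm l]
  have hself : ∀ j : ℕ, star (ζ ^ j) * ζ ^ j = 1 := fun j => by
    rw [star_pow, ← mul_pow, hstar, one_pow]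
  simp_rw [h1]
  rw [Fin.sum_univ_eq_sum_range (fun i => z ^ i)]
  split_ifs with h
  · have : z = 1 := by rw [hz, h, hself]
    simp [this]
  · have hne : z - 1 ≠ 0 := by
      intro h0
      refine h (hζ.pow_inj hk hl ?_)
      calc ζ ^ k = ζ ^ k * z := by rw [sub_eq_zero.1 h0, mul_one]
        _ = star (ζ ^ k) * ζ ^ k * ζ ^ l := by rw [hz]; ring
        _ = ζ ^ l := by rw [hself, one_mul]
    have hzN : z ^ N = 1 := by
      rw [hz, mul_pow, ← star_pow, ← pow_mul, ← pow_mul, mul_comm k, mul_comm l, pow_mul, pow_mul,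
        hζ.pow_eq_one]
      simp
    have := geom_sum_mul z N
    rw [hzN, sub_self] at this
    exact (mul_eq_zero.1 this).resolve_right hne

/-- Parseval for a vector padded with zeros to length `N`. It is applied with `m = N = n`, and with
`N = 2 * n` to the `2 * n - 1` coefficients of a product. -/
theorem IsPrimitiveRoot.sum_norm_sq_sum_pow_mul {N m : ℕ} {ζ : ℂ} (hζ : IsPrimitiveRoot ζ N)
    (hN : 0 < N) (hm : m ≤ N) (x : Fin m → ℂ) :
    ∑ i : Fin N, ‖∑ k : Fin m, ζ ^ ((i : ℕ) * k) * x k‖ ^ 2 = N * ∑ k, ‖x k‖ ^ 2 := by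
  have hsq : ∀ w : ℂ, ((‖w‖ ^ 2 : ℝ) : ℂ) = star w * w := fun w => by
    rw [mul_comm, Complex.star_def, Complex.mul_conj, Complex.normSq_eq_norm_sq]
  have : ((∑ i : Fin N, ‖∑ k : Fin m, ζ ^ ((i : ℕ) * k) * x k‖ ^ 2 : ℝ) : ℂ) =
      ((N * ∑ k, ‖x k‖ ^ 2 : ℝ) : ℂ) := by
    rw [Complex.ofReal_sum, Complex.ofReal_mul, Complex.ofReal_sum]
    simp only [hsq, star_sum, star_mul', Finset.sum_mul_sum]
    rw [Finset.sum_comm, Finset.mul_sum]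
    refine Finset.sum_congr rfl fun k _ => ?_
    rw [Finset.sum_comm]
    have h1 : ∀ l : Fin m, ∑ i : Fin N, star (ζ ^ ((i : ℕ) * k)) * star (x k) *
        (ζ ^ ((i : ℕ) * l) * x l) = (if k = l then (N : ℂ) else 0) * (star (x k) * x l) := by
      intro l
      have := hζ.sum_star_pow_mul_pow hN (k.2.trans_le hm) (l.2.trans_le hm)
      simp only [← Fin.ext_iff] at this
      rw [← this, Finset.sum_mul]
      exact Finset.sum_congr rfl fun i _ => by ring
    simp only [h1, ite_mul, zero_mul, Finset.sum_ite_eq, Finset.mem_univ, if_true,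
      Complex.ofReal_natCast]
  exact_mod_cast this

/-- The vector of the powers of `ω ^ i`. -/
noncomputable def powerVector (n : ℕ) (ω : ℂ) (i : ℕ) : EuclideanSpace ℂ (Fin n) :=
  WithLp.toLp 2 fun j => ω ^ (i * (j : ℕ))

@[simp] theorem powerVector_apply (n : ℕ) (ω : ℂ) (i : ℕ) (j : Fin n) :
    powerVector n ω i j = ω ^ (i * (j : ℕ)) := rfl

variable {n : ℕ} {ω : ℂ}

theorem IsPrimitiveRoot.inner_powerVector (hω : IsPrimitiveRoot ω n) (hn : 0 < n) (i j : Fin n) :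
    ⟪powerVector n ω i, powerVector n ω j⟫_ℂ = if i = j then (n : ℂ) else 0 := by
  have := hω.sum_star_pow_mul_pow hn i.2 j.2
  simp only [← Fin.ext_iff] at this
  rw [← this, PiLp.inner_apply]
  refine Finset.sum_congr rfl fun k _ => ?_
  rw [RCLike.inner_apply, powerVector_apply, powerVector_apply, mul_comm, mul_comm (k : ℕ),
    mul_comm (k : ℕ)]
  rfl

theorem IsPrimitiveRoot.orthonormal_powerVector (hω : IsPrimitiveRoot ω n) (hn : 0 < n) :
    Orthonormal ℂ fun i : Fin n => ((√n : ℝ) : ℂ)⁻¹ • powerVector n ω i := by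
  rw [orthonormal_iff_ite]
  intro i j
  have h : ((√n : ℝ) : ℂ) * ((√n : ℝ) : ℂ) = n := by
    rw [← Complex.ofReal_mul, Real.mul_self_sqrt (Nat.cast_nonneg n)]; simp
  have hn' : (n : ℂ) ≠ 0 := by exact_mod_cast hn.ne'
  rw [inner_smul_left, inner_smul_right, hω.inner_powerVector hn, map_inv₀, Complex.conj_ofReal,
    ← mul_assoc, ← mul_inv, h]
  split_ifs <;> simp [hn']

end Fourier

/-! ### Substituting values for the first group of inputs -/

section Circuits

variable {m n p : ℕ}

theorem aeval_bilinPoly (φ : (Fin m → ℂ) →ₗ[ℂ] (Fin n → ℂ) →ₗ[ℂ] (Fin p → ℂ)) (k : Fin p)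
    (a : Fin m → ℂ) (b : Fin n → ℂ) :
    MvPolynomial.aeval (Sum.elim a b) (bilinPoly φ k) =
      ∑ i, ∑ j, φ (Pi.single i 1) (Pi.single j 1) k * (a i * b j) := by
  simp [bilinPoly]

/-- The coefficient vector of `P`, considered as a linear form in the `Y_j`, when the values `a` are
substituted for the `X_i`. -/
noncomputable def substLeft (a : Fin m → ℂ) :
    MvPolynomial (Fin m ⊕ Fin n) ℂ →ₗ[ℂ] EuclideanSpace ℂ (Fin n) :=
  (WithLp.linearEquiv 2 ℂ (Fin n → ℂ)).symm.toLinearMap ∘ₗ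
    LinearMap.pi fun j => (MvPolynomial.aeval (Sum.elim a (Pi.single j 1))).toLinearMap

theorem substLeft_apply (a : Fin m → ℂ) (P : MvPolynomial (Fin m ⊕ Fin n) ℂ) (j : Fin n) :
    substLeft a P j = MvPolynomial.aeval (Sum.elim a (Pi.single j 1)) P := rfl

namespace BilinCircuit

variable (Γ : BilinCircuit m n)

theorem aeval_result₁ (a : Fin m → ℂ) (b : Fin n → ℂ) (i : Fin (m + Γ.r₁)) :
    MvPolynomial.aeval (Sum.elim a b) (Γ.result₁ i) = Γ.lin₁.result a i := by
  have := Γ.lin₁.map_result (MvPolynomial.aeval (R := ℂ) (Sum.elim a b)).toLinearMap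
    (fun i => MvPolynomial.X (Sum.inl i)) i
  simpa [result₁] using this

theorem aeval_result₂ (a : Fin m → ℂ) (b : Fin n → ℂ) (i : Fin (n + Γ.r₂)) :
    MvPolynomial.aeval (Sum.elim a b) (Γ.result₂ i) = Γ.lin₂.result b i := by
  have := Γ.lin₂.map_result (MvPolynomial.aeval (R := ℂ) (Sum.elim a b)).toLinearMap
    (fun i => MvPolynomial.X (Sum.inr i)) i
  simpa [result₂] using this

theorem substLeft_result₃ (a : Fin m → ℂ) (t : Fin Γ.r₃) :
    substLeft a (Γ.result₃ t) = Γ.lin₁.result a (Γ.mul t).1 •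
      Γ.lin₂.result (fun l => EuclideanSpace.single l (1 : ℂ)) (Γ.mul t).2 := by
  ext j
  rw [substLeft_apply, result₃, map_mul, aeval_result₁, aeval_result₂, PiLp.smul_apply, smul_eq_mul]
  congr 1
  have := Γ.lin₂.map_result (EuclideanSpace.proj j : EuclideanSpace ℂ (Fin n) →L[ℂ] ℂ).toLinearMap
    (fun l => EuclideanSpace.single l (1 : ℂ)) (Γ.mul t).2
  refine Eq.trans ?_ this.symm
  congr 1
  funext l
  simp [Pi.single_apply, eq_comm]

/-- A component may also occur among the results of the first two parts. Such a result involves only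
one group of variables, so its value survives setting the other group to `0`, where a bilinear
polynomial vanishes. -/
theorem substLeft_eq_zero_or_mem {φ : (Fin m → ℂ) →ₗ[ℂ] (Fin n → ℂ) →ₗ[ℂ] (Fin p → ℂ)}
    (h : Γ.Computes φ) (a : Fin m → ℂ) (k : Fin p) :
    substLeft a (bilinPoly φ k) = 0 ∨
      substLeft a (bilinPoly φ k) ∈ Set.range (Γ.lin₃.result fun t => substLeft a (Γ.result₃ t)) := by
  rcases h k with (⟨i, hi⟩ | ⟨i, hi⟩) | ⟨i, hi⟩
  · left
    ext j
    rw [substLeft_apply, ← hi, aeval_result₁, ← Γ.aeval_result₁ a 0, hi, aeval_bilinPoly]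
    simp
  · left
    ext j
    rw [substLeft_apply, ← hi, aeval_result₂, ← Γ.aeval_result₂ 0, hi, aeval_bilinPoly]
    simp
  · right
    exact ⟨i, by rw [← hi, result₄, LinCircuit.map_result]⟩

/-- Alternating forms on the components of a bilinear map, considered as linear forms in the second
argument, are bounded in terms of the size of a circuit. -/
theorem norm_alternatingMap_substLeft_le (hΓ : Γ.IsBC)
    {φ : (Fin m → ℂ) →ₗ[ℂ] (Fin n → ℂ) →ₗ[ℂ] (Fin p → ℂ)} (h : Γ.Computes φ) (a : Fin m → ℂ)
    {R : ℝ} (hR : 0 ≤ R) (ha : ∀ i, ‖Γ.lin₁.result a i‖ ≤ R) {q : ℕ}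
    (Φ : EuclideanSpace ℂ (Fin n) [⋀^Fin q]→ₗ[ℂ] ℂ)
    (hΦ : ∀ κ : Fin q → Fin n, ‖Φ fun j => EuclideanSpace.single (κ j) 1‖ ≤ 1)
    (κ : Fin q → Fin p) :
    ‖Φ fun j => substLeft a (bilinPoly φ (κ j))‖ ≤ 2 ^ (Γ.r₂ + Γ.r₄) * R ^ q := by
  have h2 := LinCircuit.norm_alternatingMap_le Φ (fun l => EuclideanSpace.single l (1 : ℂ))
    zero_le_one hΦ Γ.lin₂ hΓ.2.1
  have h3 : ∀ τ : Fin q → Fin Γ.r₃,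
      ‖Φ fun j => substLeft a (Γ.result₃ (τ j))‖ ≤ 2 ^ Γ.r₂ * R ^ q := by
    intro τ
    simp only [substLeft_result₃]
    -- Each slot carries exactly one multiplication, so all of them together cost `R ^ q`, however
    -- large `r₃` is.
    rw [Φ.map_smul_univ (fun j => Γ.lin₁.result a (Γ.mul (τ j)).1)
      (fun j => Γ.lin₂.result (fun l => EuclideanSpace.single l (1 : ℂ)) (Γ.mul (τ j)).2),
      norm_smul, norm_prod, mul_comm]
    refine mul_le_mul ((h2 _ fun j => ⟨_, rfl⟩).trans_eq (mul_one _)) ?_ (by positivity)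
      (by positivity)
    exact (Finset.prod_le_prod (fun _ _ => norm_nonneg _) fun j _ => ha _).trans_eq (by simp)
  have h4 := LinCircuit.norm_alternatingMap_le Φ (fun t => substLeft a (Γ.result₃ t))
    (by positivity) h3 Γ.lin₃ hΓ.2.2
  by_cases hz : ∃ j, substLeft a (bilinPoly φ (κ j)) = 0
  · obtain ⟨j, hj⟩ := hz
    rw [Φ.map_coord_zero j hj, norm_zero]
    positivity
  · push Not at hz
    refine (h4 _ fun j => (Γ.substLeft_eq_zero_or_mem h a (κ j)).resolve_left (hz j)).trans_eq ?_
    ring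

end BilinCircuit

theorem polyMul_single {n : ℕ} (i j : Fin n) (k : Fin (2 * n - 1)) :
    polyMul n (Pi.single i 1) (Pi.single j 1) k = if (k : ℕ) = i + j then 1 else 0 := by
  have h : ∀ i : Fin n, polyOfCoeffs n (Pi.single i 1) = Polynomial.monomial (i : ℕ) 1 := by
    intro i
    rw [polyOfCoeffs, LinearMap.sum_apply, Finset.sum_eq_single i]
    · simp
    · intro j _ hj
      simp [hj]
    · simp
  simp only [polyMul, LinearMap.compr₂_apply, LinearMap.compl₁₂_apply, h, LinearMap.mul_apply',
    coeffsOfPoly, LinearMap.pi_apply, Polynomial.lcoeff_apply, Polynomial.monomial_mul_monomial,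
    Polynomial.coeff_monomial, mul_one, eq_comm]

/-- Evaluation of a product of polynomials is multiplicative. -/
theorem sum_pow_smul_substLeft_polyMul {n : ℕ} (ω : ℂ) (i : ℕ) (a : Fin n → ℂ) :
    ∑ k : Fin (2 * n - 1), ω ^ (i * (k : ℕ)) • substLeft a (bilinPoly (polyMul n) k) =
      (∑ l : Fin n, ω ^ (i * (l : ℕ)) * a l) • powerVector n ω i := by
  ext j
  rw [WithLp.ofLp_sum, Finset.sum_apply, PiLp.smul_apply, smul_eq_mul, powerVector_apply, Finset.sum_mul]
  have h : ∀ k : Fin (2 * n - 1), (ω ^ (i * (k : ℕ)) • substLeft a (bilinPoly (polyMul n) k)) j =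
      ∑ l : Fin n, if (k : ℕ) = l + j then ω ^ (i * (k : ℕ)) * a l else 0 := by
    intro k
    rw [PiLp.smul_apply, substLeft_apply, aeval_bilinPoly, smul_eq_mul, Finset.mul_sum]
    refine Finset.sum_congr rfl fun l _ => ?_
    rw [Finset.sum_eq_single j]
    · rw [polyMul_single]
      split_ifs <;> simp
    · intro j' _ hj'
      simp [hj']
    · simp
  refine (Finset.sum_congr rfl fun k _ => h k).trans ?_
  rw [Finset.sum_comm]
  refine Finset.sum_congr rfl fun l _ => ?_
  have hlt : (l : ℕ) + j < 2 * n - 1 := by omega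
  rw [Finset.sum_eq_single ⟨l + j, hlt⟩]
  · simp [mul_add, pow_add]; ring
  · intro k _ hk
    rw [if_neg fun e => hk (Fin.ext e)]
  · simp

end Circuits

/-! ### A good input, and the resulting volume inequality -/

/-- The inner product is conjugate linear on the left, hence the conjugated input. -/
theorem LinCircuit.result_star_eq_inner {n r : ℕ} (Γ : LinCircuit n r)
    (α : EuclideanSpace ℂ (Fin n)) (i : Fin (n + r)) :
    Γ.result (fun l => star (α l)) i =
      ⟪α, Γ.result (fun l => EuclideanSpace.single l (1 : ℂ)) i⟫_ℂ := by
  have := Γ.map_result (innerSL ℂ α).toLinearMap (fun l => EuclideanSpace.single l (1 : ℂ)) i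
  refine Eq.trans ?_ this.symm
  congr 1
  funext l
  simp [EuclideanSpace.inner_single_right]

theorem inner_powerVector_eq {n : ℕ} (ω : ℂ) (i : ℕ) (α : EuclideanSpace ℂ (Fin n)) :
    ⟪α, powerVector n ω i⟫_ℂ = ∑ l : Fin n, ω ^ (i * (l : ℕ)) * star (α l) := by
  rw [PiLp.inner_apply]
  rfl

/-- The values of a product polynomial at the `n`-th roots of unity, in terms of its coefficients. -/
theorem IsPrimitiveRoot.sum_norm_sq_coeff_le {n : ℕ} {ζ : ℂ} (hn : 0 < n)
    (hζ : IsPrimitiveRoot ζ (2 * n)) (x : Fin (2 * n - 1) → ℂ) :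
    ∑ i : Fin n, ‖∑ k : Fin (2 * n - 1), (ζ ^ 2) ^ ((i : ℕ) * (k : ℕ)) * x k‖ ^ 2 ≤
      (2 * n : ℝ) * ∑ k, ‖x k‖ ^ 2 := by
  have h := hζ.sum_norm_sq_sum_pow_mul (by omega) (Nat.sub_le _ 1) x
  push_cast at h
  rw [← h]
  -- The `n`-th roots of unity are the even powers of `ζ`; dropping the odd ones only decreases the
  -- sum.
  let g : Fin n → Fin (2 * n) := fun i => ⟨2 * i, by omega⟩
  have hg : Function.Injective g := by
    intro i j hij
    have := congrArg Fin.val hij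
    simp only [g] at this
    exact Fin.ext (by omega)
  calc _ = ∑ i ∈ Finset.univ.image g, ‖∑ k : Fin (2 * n - 1), ζ ^ ((i : ℕ) * k) * x k‖ ^ 2 := by
        rw [Finset.sum_image fun _ _ _ _ e => hg e]
        refine Finset.sum_congr rfl fun i _ => ?_
        simp only [← pow_mul, g, mul_assoc]
    _ ≤ _ := Finset.sum_le_sum_of_subset_of_nonneg (Finset.subset_univ _) fun _ _ _ => by positivity

/-- The normalised power vectors form an orthonormal basis, so each `u m` contributes `1`. -/
theorem sum_sum_norm_sq_inner_powerVector {n p : ℕ} (hn : 0 < n) {ω : ℂ}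
    (hω : IsPrimitiveRoot ω n) {u : Fin p → EuclideanSpace ℂ (Fin n)} (hu : Orthonormal ℂ u) :
    ∑ i : Fin n, ∑ m, ‖⟪u m, ((√n : ℝ) : ℂ)⁻¹ • powerVector n ω i⟫_ℂ‖ ^ 2 = p := by
  have hn' : (n : ℝ) ≠ 0 := by exact_mod_cast hn.ne'
  have h : ∀ m, ∑ i : Fin n, ‖⟪u m, ((√n : ℝ) : ℂ)⁻¹ • powerVector n ω i⟫_ℂ‖ ^ 2 = 1 := by
    intro m
    have h1 := hω.sum_norm_sq_sum_pow_mul hn le_rfl fun l => star (u m l)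
    have h2 : ∑ l, ‖star (u m l)‖ ^ 2 = 1 := by
      simp only [norm_star]
      rw [← EuclideanSpace.norm_sq_eq, hu.1 m, one_pow]
    rw [h2, mul_one] at h1
    simp only [inner_smul_right, inner_powerVector_eq, norm_mul, mul_pow]
    rw [← Finset.mul_sum, h1, norm_inv, Complex.norm_real, Real.norm_eq_abs, inv_pow, sq_abs,
      Real.sq_sqrt (Nat.cast_nonneg n), inv_mul_cancel₀ hn']
  rw [Finset.sum_comm]
  simp only [h, Finset.sum_const, Finset.card_univ, Fintype.card_fin, nsmul_eq_mul, mul_one]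

/-- A linear circuit with bounded coefficients has inputs on which all its results are small while
many values of the discrete Fourier transform of the input are not. -/
theorem LinCircuit.exists_input {n r r₁ : ℕ} (hn : 0 < n) (hr : 0 < r)
    (hr' : (r : ℝ) - 1 < -(27 / 200) * n + 3 / 8 * (n - r : ℕ)) (Γ : LinCircuit n r₁)
    (hΓ : Γ.IsBC) {ρ D : ℝ} (hρ : 0 ≤ ρ) (hρ' : 400 * (n + r₁ : ℕ) ≤ Real.exp (ρ ^ 2 / 8))
    (hD : 0 < D) (hDr : D ^ r = 2 ^ r₁) {ω : ℂ} (hω : IsPrimitiveRoot ω n) :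
    ∃ (a : Fin n → ℂ) (ι : Fin r → Fin n), Function.Injective ι ∧
      (∀ i, ‖Γ.result a i‖ ≤ ρ * D) ∧
      ∀ j, (n : ℝ) / 6 ≤ ‖∑ l : Fin n, ω ^ ((ι j : ℕ) * (l : ℕ)) * a l‖ ^ 2 := by
  have hr1 : (1 : ℝ) ≤ r := by exact_mod_cast hr
  have hn' : (0 : ℝ) < n := by exact_mod_cast hn
  obtain ⟨c, hcdef⟩ : ∃ c : Fin (n + r₁) → EuclideanSpace ℂ (Fin n),
    c = Γ.result fun l => EuclideanSpace.single l (1 : ℂ) := ⟨_, rfl⟩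
  have hvol : ∀ v : Fin r → EuclideanSpace ℂ (Fin n), Orthonormal ℂ v →
      ∀ κ : Fin r → Fin (n + r₁), ‖gramForm v fun j => c (κ j)‖ ≤ D ^ r := by
    intro v hv κ
    rw [hDr, ← mul_one (2 ^ r₁ : ℝ)]
    exact LinCircuit.norm_alternatingMap_le (gramForm v)
      (fun l => EuclideanSpace.single l (1 : ℂ)) zero_le_one
      (norm_gramForm_single_le hv) Γ hΓ _ fun j => ⟨κ j, by rw [hcdef]⟩
  obtain ⟨u, hu, huc⟩ := exists_orthonormal_sum_inner_le hD.le hr hvol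
  obtain ⟨w, hwdef⟩ : ∃ w : Fin n → EuclideanSpace ℂ (Fin n),
    w = fun i : Fin n => ((√n : ℝ) : ℂ)⁻¹ • powerVector n ω i := ⟨_, rfl⟩
  have hw : Orthonormal ℂ w := hwdef ▸ hω.orthonormal_powerVector hn
  have hsum : ∑ i : Fin n, ∑ m, ‖⟪u m, w i⟫_ℂ‖ ^ 2 = (n - r : ℕ) := by
    rw [hwdef]; exact sum_sum_norm_sq_inner_powerVector hn hω hu
  -- With `s = r - 1`, the strict lower bound on an integer count yields at least `r` indices.
  obtain ⟨x, hxc, hxb⟩ := exists_signs (fun i m => ⟪u m, w i⟫_ℂ) (fun k m => ⟪u m, c k⟫_ℂ) hD hρ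
    (fun i => by simpa [hw.1 i] using hu.sum_inner_products_le (w i) (s := Finset.univ)) huc hρ'
    (s := (r : ℝ) - 1) (by rwa [hsum]) (by linarith)
  have hcard : r ≤ (Finset.univ.filter fun i => 1 / 6 ≤ ‖∑ m, x m * ⟪u m, w i⟫_ℂ‖ ^ 2).card := by
    rw [sub_lt_iff_lt_add] at hxb
    exact Nat.lt_succ_iff.1 (by exact_mod_cast hxb)
  obtain ⟨S, hS, hSr⟩ := Finset.exists_subset_card_eq hcard
  have hα : ∀ v, ⟪∑ m, (x m : ℂ) • u m, v⟫_ℂ = ∑ m, x m * ⟪u m, v⟫_ℂ := by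
    intro v
    simp only [sum_inner, inner_smul_left, Complex.conj_ofReal]
  refine ⟨fun l => star ((∑ m, (x m : ℂ) • u m) l), S.orderEmbOfFin hSr,
    (S.orderEmbOfFin hSr).injective, fun i => ?_, fun j => ?_⟩
  · rw [Γ.result_star_eq_inner, hα, ← hcdef]
    exact hxc i
  · have h := (Finset.mem_filter.1 (hS (S.orderEmbOfFin_mem hSr j))).2
    rw [← hα, hwdef, inner_smul_right, norm_mul, mul_pow, norm_inv, Complex.norm_real,
      Real.norm_eq_abs, inv_pow, sq_abs, Real.sq_sqrt hn'.le, inner_powerVector_eq,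
      inv_mul_eq_div, le_div_iff₀ hn'] at h
    linarith

/-- The Gram form of the `r` normalised power vectors selected by `ι` is estimated on the
evaluations of the product. Below, it is a product of `r` factors of squared modulus at least `n² /
6`. Above, one factor `(2 * n) ^ r` is Parseval's constant and the other bounds the number of
`r`-tuples of components. -/
theorem BilinCircuit.factorial_mul_pow_le {n r : ℕ} (hn : 0 < n) {Γ : BilinCircuit n n}
    (hΓ : Γ.IsBC) (hc : Γ.Computes (polyMul n)) {ζ : ℂ} (hζ : IsPrimitiveRoot ζ (2 * n))
    {a : Fin n → ℂ} {ι : Fin r → Fin n} (hι : Function.Injective ι) {R : ℝ} (hR : 0 ≤ R)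
    (ha : ∀ i, ‖Γ.lin₁.result a i‖ ≤ R)
    (hι6 : ∀ j, (n : ℝ) / 6 ≤ ‖∑ l : Fin n, (ζ ^ 2) ^ ((ι j : ℕ) * (l : ℕ)) * a l‖ ^ 2) :
    (r.factorial : ℝ) * ((n : ℝ) ^ 2 / 6) ^ r ≤
      (2 * n) ^ r * ((2 * n) ^ r * (2 ^ (Γ.r₂ + Γ.r₄) * R ^ r) ^ 2) := by
  have hω : IsPrimitiveRoot (ζ ^ 2) n := hζ.pow (by omega) rfl
  have hn' : (0 : ℝ) < n := by exact_mod_cast hn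
  obtain ⟨w, hwdef⟩ : ∃ w : Fin n → EuclideanSpace ℂ (Fin n),
    w = fun i : Fin n => ((√n : ℝ) : ℂ)⁻¹ • powerVector n (ζ ^ 2) i := ⟨_, rfl⟩
  have hw : Orthonormal ℂ w := hwdef ▸ hω.orthonormal_powerVector hn
  have hwι : Orthonormal ℂ fun j => w (ι j) := hw.comp ι hι
  obtain ⟨Φ, hΦ⟩ : ∃ Φ, Φ = gramForm fun j => w (ι j) := ⟨_, rfl⟩
  obtain ⟨t, ht⟩ : ∃ t : Fin (2 * n - 1) → EuclideanSpace ℂ (Fin n),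
    t = fun k => substLeft a (bilinPoly (polyMul n) k) := ⟨_, rfl⟩
  obtain ⟨M, hM⟩ : ∃ M : ℝ, M = 2 ^ (Γ.r₂ + Γ.r₄) * R ^ r := ⟨_, rfl⟩
  have hΦM : ∀ κ : Fin r → Fin (2 * n - 1), ‖Φ fun j => t (κ j)‖ ≤ M := by
    rw [hM, ht]
    exact Γ.norm_alternatingMap_substLeft_le hΓ hc a hR ha Φ (hΦ ▸ norm_gramForm_single_le hwι)
  have hL : ∀ i : Fin n, ∑ k : Fin (2 * n - 1), (ζ ^ 2) ^ ((i : ℕ) * (k : ℕ)) • t k =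
      ((√n : ℝ) * ∑ l : Fin n, (ζ ^ 2) ^ ((i : ℕ) * (l : ℕ)) * a l) • w i := by
    intro i
    have hs : ((√n : ℝ) : ℂ) ≠ 0 := by exact_mod_cast (Real.sqrt_pos.2 hn').ne'
    rw [ht, sum_pow_smul_substLeft_polyMul, hwdef, smul_smul]
    congr 1
    field_simp
  have hlow : ((n : ℝ) ^ 2 / 6) ^ r ≤ ‖Φ fun j => ∑ k : Fin (2 * n - 1),
      (ζ ^ 2) ^ ((ι j : ℕ) * (k : ℕ)) • t k‖ ^ 2 := by
    have h1 : Φ (fun j => w (ι j)) = 1 := by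
      rw [hΦ, gramForm_apply, ← Matrix.det_one (n := Fin r) (R := ℂ)]
      congr 1
      ext i j
      simp [orthonormal_iff_ite.1 hwι, Matrix.one_apply, eq_comm]
    simp only [hL]
    rw [Φ.map_smul_univ (fun j => ((√n : ℝ) : ℂ) * ∑ l : Fin n,
      (ζ ^ 2) ^ ((ι j : ℕ) * (l : ℕ)) * a l) fun j => w (ι j), h1,
      smul_eq_mul, mul_one, norm_prod, ← Finset.prod_pow]
    rw [show ((n : ℝ) ^ 2 / 6) ^ r = ∏ _j : Fin r, ((n : ℝ) ^ 2 / 6) by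
      rw [Finset.prod_const, Finset.card_univ, Fintype.card_fin]]
    refine Finset.prod_le_prod (fun _ _ => by positivity) fun j _ => ?_
    rw [norm_mul, mul_pow, Complex.norm_real, Real.norm_eq_abs, sq_abs, Real.sq_sqrt hn'.le]
    have := mul_le_mul_of_nonneg_left (hι6 j) hn'.le
    linarith
  have hup := MultilinearMap.sum_norm_sq_le
    (fun (i : Fin n) (k : Fin (2 * n - 1)) => (ζ ^ 2) ^ ((i : ℕ) * (k : ℕ))) (by positivity)
    (hζ.sum_norm_sq_coeff_le hn) t r Φ.toMultilinearMap
  have hfac := Φ.factorial_mul_norm_sq_le (fun i : Fin n => ∑ k : Fin (2 * n - 1),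
      (ζ ^ 2) ^ ((i : ℕ) * (k : ℕ)) • t k) ι hι
  have hsumM : ∑ τ : Fin r → Fin (2 * n - 1), ‖Φ fun j => t (τ j)‖ ^ 2 ≤ (2 * n) ^ r * M ^ 2 := by
    refine (Finset.sum_le_sum fun τ _ => pow_le_pow_left₀ (norm_nonneg _) (hΦM τ) 2).trans ?_
    rw [Finset.sum_const, nsmul_eq_mul, Finset.card_univ, Fintype.card_fun, Fintype.card_fin,
      Fintype.card_fin, Nat.cast_pow]
    refine mul_le_mul_of_nonneg_right (pow_le_pow_left₀ (Nat.cast_nonneg _) ?_ r) (sq_nonneg M)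
    exact_mod_cast Nat.sub_le _ _
  rw [← hM]
  exact (mul_le_mul_of_nonneg_left hlow (Nat.cast_nonneg _)).trans
    (hfac.trans (hup.trans (mul_le_mul_of_nonneg_left hsumM (by positivity))))

/-! ### Numerical conclusion -/

theorem div_pow_le_factorial {n r : ℕ} (hrn : n ≤ 6 * r) : ((n : ℝ) / 18) ^ r ≤ r.factorial := by
  have h1 := Real.pow_div_factorial_le_exp (r : ℝ) (Nat.cast_nonneg r) r
  have h2 : Real.exp r ≤ 3 ^ r := by
    rw [← mul_one (r : ℝ), Real.exp_nat_mul]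
    exact pow_le_pow_left₀ (Real.exp_pos _).le Real.exp_one_lt_three.le r
  have h3 := h1.trans h2
  rw [div_le_iff₀ (by positivity)] at h3
  have h4 : ((n : ℝ) / 18) ^ r ≤ ((r : ℝ) / 3) ^ r := by
    refine pow_le_pow_left₀ (by positivity) ?_ r
    have : (n : ℝ) ≤ 6 * r := by exact_mod_cast hrn
    linarith
  refine h4.trans ?_
  rw [div_pow, div_le_iff₀ (by positivity)]
  linarith

theorem BilinCircuit.pow_le_of_computes_polyMul {n r : ℕ} (hn : 0 < n) (hr : 0 < r)
    (hrn : n ≤ 6 * r) (hr' : (r : ℝ) - 1 < -(27 / 200) * n + 3 / 8 * (n - r : ℕ))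
    {Γ : BilinCircuit n n} (hΓ : Γ.IsBC) (hc : Γ.Computes (polyMul n)) {ρ : ℝ} (hρ : 0 ≤ ρ)
    (hρ' : 400 * (n + Γ.r₁ : ℕ) ≤ Real.exp (ρ ^ 2 / 8)) :
    (n : ℝ) ^ r ≤ (432 * ρ ^ 2) ^ r * 4 ^ Γ.size := by
  have hr0 : (0 : ℝ) < r := by exact_mod_cast hr
  obtain ⟨D, hD, hDr⟩ : ∃ D : ℝ, 0 < D ∧ D ^ r = 2 ^ Γ.r₁ := by
    -- This choice makes `(ρ * D) ^ r` contribute exactly `2 ^ r₁`, so the first part enters the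
    -- final bound like the other linear parts.
    refine ⟨2 ^ ((Γ.r₁ : ℝ) / r), by positivity, ?_⟩
    rw [← Real.rpow_natCast, ← Real.rpow_mul zero_le_two, div_mul_cancel₀ _ hr0.ne',
      Real.rpow_natCast]
  have hζ := Complex.isPrimitiveRoot_exp (2 * n) (by omega)
  obtain ⟨a, ι, hι, ha, hι6⟩ := Γ.lin₁.exists_input hn hr hr' hΓ.1 hρ hρ' hD hDr
    (hζ.pow (by omega) rfl)
  have hmain := factorial_mul_pow_le hn hΓ hc hζ hι (by positivity) ha hι6
  have hMsq : (2 ^ (Γ.r₂ + Γ.r₄) * (ρ * D) ^ r) ^ 2 ≤ (ρ ^ 2) ^ r * 4 ^ Γ.size := by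
    have e : (2 ^ (Γ.r₂ + Γ.r₄) * (ρ * D) ^ r) ^ 2 =
        (ρ ^ 2) ^ r * 4 ^ (Γ.r₁ + Γ.r₂ + Γ.r₄) := by
      rw [mul_pow ρ D, hDr, show (4 : ℝ) = 2 ^ 2 by norm_num]
      simp only [mul_pow, ← pow_mul, pow_add]
      ring
    rw [e]
    refine mul_le_mul_of_nonneg_left (pow_le_pow_right₀ (by norm_num) ?_) (by positivity)
    simp only [BilinCircuit.size]
    omega
  have hn2 : (0 : ℝ) < ((n : ℝ) ^ 2) ^ r := by
    have : (0 : ℝ) < n := by exact_mod_cast hn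
    positivity
  have hfin : ((n : ℝ) / 18) ^ r * ((n : ℝ) ^ 2 / 6) ^ r ≤
      (2 * n) ^ r * ((2 * n) ^ r * ((ρ ^ 2) ^ r * 4 ^ Γ.size)) :=
    (mul_le_mul_of_nonneg_right (div_pow_le_factorial hrn) (by positivity)).trans
      (hmain.trans (by gcongr))
  -- Here `108 = 18 * 6` clears the denominators, and `432 = 4 * 108` absorbs the two factors `2 ^
  -- r`.
  have e1 : ((n : ℝ) / 18) ^ r * ((n : ℝ) ^ 2 / 6) ^ r * 108 ^ r =
      (n : ℝ) ^ r * ((n : ℝ) ^ 2) ^ r := by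
    rw [← mul_pow, ← mul_pow, ← mul_pow]; congr 1; ring
  have e2 : (2 * (n : ℝ)) ^ r * ((2 * n) ^ r * ((ρ ^ 2) ^ r * 4 ^ Γ.size)) * 108 ^ r =
      (432 * ρ ^ 2) ^ r * 4 ^ Γ.size * ((n : ℝ) ^ 2) ^ r := by
    have : (432 * ρ ^ 2) ^ r * ((n : ℝ) ^ 2) ^ r =
        (2 * (n : ℝ)) ^ r * (2 * n) ^ r * (ρ ^ 2) ^ r * 108 ^ r := by
      rw [← mul_pow, ← mul_pow, ← mul_pow, ← mul_pow]; congr 1; ring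
    linear_combination (-(4 : ℝ) ^ Γ.size) * this
  refine le_of_mul_le_mul_right ?_ hn2
  rw [← e1, ← e2]
  exact mul_le_mul_of_nonneg_right hfin (by positivity)

theorem logb_le_of_computes_polyMul {n : ℕ} (hn : 800 ≤ n) {Γ : BilinCircuit n n} (hΓ : Γ.IsBC)
    (hc : Γ.Computes (polyMul n)) :
    (1 / 12 : ℝ) * n * Real.logb 2 n - 10 * (n * Real.logb 2 (Real.logb 2 n)) ≤ Γ.size := by
  have hn' : (800 : ℝ) ≤ n := by exact_mod_cast hn
  have hn0 : (0 : ℝ) < n := by linarith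
  set l := Real.logb 2 n with hl
  have h2l : (2 : ℝ) ^ l = n := Real.rpow_logb (by norm_num) (by norm_num) hn0
  have hl8 : 8 ≤ l := by
    rw [hl, Real.le_logb_iff_rpow_le (by norm_num) hn0]
    norm_num
    linarith
  have hloglog : 1 ≤ Real.logb 2 l := by
    rw [Real.le_logb_iff_rpow_le (by norm_num) (by linarith)]
    norm_num
    linarith
  -- Assuming the circuit small bounds `r₁` by `n ^ 2`, so that `ρ` of order `√(log n)` suffices for
  -- the union bound over all results of the first part.
  by_contra! hcon
  have hlog : Real.log n = l * Real.log 2 := by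
    rw [hl, Real.logb, div_mul_cancel₀ _ (Real.log_pos one_lt_two).ne']
  have hlog2 : Real.log 2 ≤ 1 := (Real.log_two_lt_d9.le).trans (by norm_num)
  have hlog2' : 1 / 2 ≤ Real.log 2 := le_trans (by norm_num) Real.log_two_gt_d9.le
  have hln : l ≤ 2 * n := by
    have := Real.log_le_sub_one_of_pos hn0
    rw [hlog] at this
    nlinarith
  have hsize : (Γ.size : ℝ) ≤ n ^ 2 := by nlinarith
  have hr₁ : (Γ.r₁ : ℝ) ≤ Γ.size := by
    have : Γ.r₁ ≤ Γ.size := by simp only [BilinCircuit.size]; omega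
    exact_mod_cast this
  -- This makes `exp (ρ² / 8) = n ^ 3`, which dominates `400 * (n + n ^ 2)` for `n ≥ 800`.
  set ρ := √(24 * Real.log n) with hρ
  have hρ2 : ρ ^ 2 = 24 * Real.log n := Real.sq_sqrt (by
    have := Real.log_nonneg (by linarith : (1 : ℝ) ≤ n); positivity)
  have hexp : Real.exp (ρ ^ 2 / 8) = (n : ℝ) ^ 3 := by
    rw [hρ2, show 24 * Real.log n / 8 = (3 : ℕ) * Real.log n by push_cast; ring, Real.exp_nat_mul,
      Real.exp_log hn0]
  -- This is `n / 6` rounded up. It is admissible for large `n` because `1/6 < -27/200 + (3/8) *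
  -- (5/6)`.
  set r := (n + 5) / 6 with hr
  have h6r : n ≤ 6 * r := by omega
  have h6r' : 6 * r ≤ n + 5 := by omega
  have h6 : (n : ℝ) ≤ 6 * r := by exact_mod_cast h6r
  have h6' : 6 * (r : ℝ) ≤ n + 5 := by exact_mod_cast h6r'
  have key := BilinCircuit.pow_le_of_computes_polyMul (n := n) (r := r) (by omega)
    (by omega) h6r (by
      rw [Nat.cast_sub (by omega)]; linarith) hΓ hc (Real.sqrt_nonneg _) (by
      rw [hexp]; push_cast; nlinarith)
  have hle : (n : ℝ) ^ r ≤ (2 ^ 14 * l) ^ r * 4 ^ Γ.size := by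
    refine key.trans (mul_le_mul_of_nonneg_right (pow_le_pow_left₀ (by positivity) ?_ r)
      (by positivity))
    rw [hρ2, hlog]
    nlinarith
  have hlogle := Real.logb_le_logb_of_le one_lt_two (pow_pos hn0 r) hle
  have e4 : Real.logb 2 4 = 2 := by
    rw [show (4 : ℝ) = 2 ^ (2 : ℕ) by norm_num, Real.logb_pow, Real.logb_self_eq_one one_lt_two]
    norm_num
  rw [Real.logb_mul (by positivity) (by positivity), Real.logb_pow, Real.logb_pow, Real.logb_pow,
    Real.logb_mul (by positivity) (by positivity), Real.logb_pow, Real.logb_self_eq_one one_lt_two,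
    e4, ← hl] at hlogle
  push_cast at hlogle
  set L := Real.logb 2 l
  -- If `l ≤ 15 * L` the claimed lower bound is not positive. Otherwise `l - 15 * L` is positive and
  -- `r` may be replaced by its lower bound `n / 6`; the `15` is `14 + 1`, using `1 ≤ L`.
  by_cases hneg : l ≤ 15 * L
  · have : (n : ℝ) * l ≤ n * (15 * L) := mul_le_mul_of_nonneg_left hneg hn0.le
    have h0 : (0 : ℝ) ≤ Γ.size := Nat.cast_nonneg _
    have : 0 ≤ (n : ℝ) * L := by positivity
    linarith
  · push Not at hneg
    have hr0 : (0 : ℝ) ≤ r := Nat.cast_nonneg r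
    have h1 : (r : ℝ) * (l - 15 * L) ≤ 2 * Γ.size := by nlinarith
    have h2 : (n : ℝ) * (l - 15 * L) ≤ 6 * r * (l - 15 * L) :=
      mul_le_mul_of_nonneg_right h6 (by linarith)
    have : 0 ≤ (n : ℝ) * L := by positivity
    linarith

/-- For these `n` the claimed bound is not positive: `log n ≤ 10`, while `3² ≥ 2³` and `(3/2)² ≥ 2`
give `log log n ≥ 1/2`. -/
theorem logb_le_of_lt {n : ℕ} (hn : 3 ≤ n) (hn' : n < 800) :
    (1 / 12 : ℝ) * n * Real.logb 2 n ≤ 10 * (n * Real.logb 2 (Real.logb 2 n)) := by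
  have h3 : (3 : ℝ) ≤ n := by exact_mod_cast hn
  have h800 : (n : ℝ) < 800 := by exact_mod_cast hn'
  have hpow : ∀ {x : ℝ} {p q : ℕ}, 0 < x → 0 < q → (2 : ℝ) ^ p ≤ x ^ q →
      (p : ℝ) / q ≤ Real.logb 2 x := by
    intro x p q hx hq h
    have := Real.logb_le_logb_of_le one_lt_two (by positivity) h
    rw [Real.logb_pow, Real.logb_pow, Real.logb_self_eq_one one_lt_two, mul_one] at this
    rw [div_le_iff₀ (by exact_mod_cast hq)]
    linarith
  have h1 : (3 / 2 : ℝ) ≤ Real.logb 2 n := by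
    have := hpow (x := n) (p := 3) (q := 2) (by linarith) (by norm_num) (by nlinarith)
    exact_mod_cast this
  have h2 : (1 / 2 : ℝ) ≤ Real.logb 2 (Real.logb 2 n) := by
    have := hpow (x := Real.logb 2 n) (p := 1) (q := 2) (by linarith) (by norm_num) (by nlinarith)
    exact_mod_cast this
  have h4 : Real.logb 2 n ≤ 10 := by
    rw [Real.logb_le_iff_le_rpow one_lt_two (by linarith)]
    norm_num
    linarith
  nlinarith

theorem mainTheorem2 :
    ∃ C : ℝ, ∀ n : ℕ, 3 ≤ n →
      (1 / 12 : ℝ) * n * Real.logb 2 n - C * (n * Real.logb 2 (Real.logb 2 n))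
        ≤ (bcComplexity (polyMul n) : ℝ) := by
  refine ⟨10, fun n hn => ?_⟩
  rcases lt_or_ge n 800 with h | h
  · linarith [logb_le_of_lt hn h, Nat.cast_nonneg (α := ℝ) (bcComplexity (polyMul n))]
  -- Nonemptiness matters: the infimum of the empty set of naturals is `0`.
  · have hne : {s : ℕ | ∃ Γ : BilinCircuit n n,
        Γ.IsBC ∧ Γ.Computes (polyMul n) ∧ Γ.size = s}.Nonempty := by
      obtain ⟨Γ, hΓ, hc⟩ := exists_bilinCircuit (by omega) (by omega) (polyMul n)
      exact ⟨_, Γ, hΓ, hc, rfl⟩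
    obtain ⟨Γ, hΓ, hc, hs⟩ := Nat.sInf_mem hne
    rw [bcComplexity, ← hs]
    exact logb_le_of_computes_polyMul h hΓ hc
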